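/- Let $q=\exp\hbar\in\mathbb C[[\hbar]]$, let $(a_{ij})_{1\le i,j\le4}$ be the Cartan matrix of type $A_4$, and let $U_q(\mathfrak{sl}_5)$ be the $\hbar$-adically complete $\mathbb C[[\hbar]]$-algebra topologically generated by $h_{\alpha_i},e_{\alpha_i},e_{-\alpha_i}$ ($1\le i\le 4$) with the relations $[h_{\alpha_i},h_{\alpha_j}]=0$, $[h_{\alpha_i},e_{\pm\alpha_j}]=\pm a_{ij}e_{\pm\alpha_j}$, $[e_{\alpha_i},e_{-\alpha_j}]=\delta_{ij}\frac{q^{h_{\alpha_i}}-q^{-h_{\alpha_i}}}{q-q^{-1}}$, $e_{\pm\alpha_i}^2e_{\pm\alpha_j}-(q+q^{-1})e_{\pm\alpha_i}e_{\pm\alpha_j}e_{\pm\alpha_i}+e_{\pm\alpha_j}e_{\pm\alpha_i}^2=0$ for $|i-j|=1$, and $[e_{\pm\alpha_i},e_{\pm\alpha_j}]=0$ for $|i-j|\ne1$. It is a topological Hopf algebra (with coproduct valued in the completed tensor square) with $$\Delta(h_{\alpha_i})=h_{\alpha_i}\otimes1+1\otimes h_{\alpha_i},\quad \Delta(e_{\alpha_i})=q^{-h_{\alpha_i}}\otimes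 e_{\alpha_i}+e_{\alpha_i}\otimes1,\quad \Delta(e_{-\alpha_i})=e_{-\alpha_i}\otimes q^{h_{\alpha_i}}+1\otimes e_{-\alpha_i},$$ $S(h_{\alpha_i})=-h_{\alpha_i}$, $S(e_{\alpha_i})=-q^{h_{\alpha_i}}e_{\alpha_i}$, $S(e_{-\alpha_i})=-e_{-\alpha_i}q^{-h_{\alpha_i}}$, and counit zero on all these generators. Let $\mathfrak h$ be the Cartan subalgebra of $\mathfrak{sl}_5$, with basis $h_{\alpha_1},\dots,h_{\alpha_4}$, and let $$\begin{aligned}r_0(5)={}&h_{\alpha_1}\otimes\left(\tfrac25h_{\alpha_1}+\tfrac35h_{\alpha_2}+\tfrac35h_{\alpha_3}+\tfrac25h_{\alpha_4}\right)+h_{\alpha_2}\otimes\left(\tfrac35h_{\alpha_2}+\tfrac45h_{\alpha_3}+\tfrac35h_{\alpha_4}\right)\\&+h_{\alpha_3}\otimes\left(-\tfrac15h_{\alpha_1}+\tfrac35h_{\alpha_3}+\tfrac35h_{\alpha_4}\right)+h_{\alpha_4}\otimes\left(-\tfrac15h_{\alpha_1}-\tfrac15h_{\alpha_2}+\tfrac25h_{\alpha_4}\right)\in\mathfrak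 h\otimes\mathfrak h .\end{aligned}$$ Then: (1) $r_0(5)$ is the Cartan part of the Cremmer–Gervais $r$-matrix for $\mathfrak{sl}_5$, i.e. it is the unique $r\in\mathfrak h\otimes\mathfrak h$ with $r+r^{21}=\Omega_0$ and $(\alpha_{i+1}\otimes1+1\otimes\alpha_i)(r)=0$ for $i=1,2,3$, where $\Omega_0$ is the Cartan part of the quadratic Casimir element (for the invariant form with $(\alpha_i,\alpha_i)=2$). (2) Let $\mathcal K_5=q^{r_0(5)}=\exp(\hbar\, r_0(5))\in U_q(\mathfrak{sl}_5)\,\hat\otimes\, U_q(\mathfrak{sl}_5)$. The algebra $U_q(\mathfrak{sl}_5)$ with the same counit and the twisted coproduct $\Delta^{\mathcal K_5}(a)=\mathcal K_5\Delta(a)\mathcal K_5^{-1}$ is a topological Hopf algebra $U_q^{\mathcal K_5}(\mathfrak{sl}_5)$, and the quantum seaweed algebra $U_q(SW_5')$, i.e. the subalgebra topologically generated by $h_{\alpha_2},h_{\alpha_3}$, $p_5=\tfrac35h_{\alpha_1}+\tfrac15h_{\alpha_2}-\tfrac15h_{\alpha_3}-\tfrac35h_{\alpha_4}$, $e_{-\alpha_1},e_{\alpha_4},e_{\pm\alpha_2},e_{\pm\alpha_3}$,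 is a Hopf subalgebra of it: $\Delta^{\mathcal K_5}$ maps $U_q(SW_5')$ into (the image of) $U_q(SW_5')\,\hat\otimes\,U_q(SW_5')$, and the antipode of $U_q^{\mathcal K_5}(\mathfrak{sl}_5)$ maps $U_q(SW_5')$ into itself. -/

import Mathlib

open scoped TensorProduct

noncomputable section

/-! ### Complete algebras over the ring `ℂ⟦ħ⟧` of formal power series -/

/-- The ground ring `ℂ⟦ħ⟧`. -/
abbrev Kh : Type := PowerSeries ℂ

/-- The formal parameter `ħ`. -/
abbrev hbar : Kh := PowerSeries.X

/-- `q = exp ħ`. -/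
def qK : Kh := PowerSeries.exp ℂ

/-- `q⁻¹ = exp (-ħ)`. -/
def qKinv : Kh := PowerSeries.evalNegHom (PowerSeries.exp ℂ)

theorem qK_mul_qKinv : qK * qKinv = 1 := PowerSeries.exp_mul_exp_neg_eq_one

section Completion

variable (A : Type*) [Ring A] [Algebra Kh A]

/-- The two-sided ideal `ħⁿ A` of a `ℂ⟦ħ⟧`-algebra `A`. -/
def hIdeal (n : ℕ) : Ideal A where
  carrier := {x | ∃ y : A, x = hbar ^ n • y}
  add_mem' := by
    rintro _ _ ⟨y, rfl⟩ ⟨z, rfl⟩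
    exact ⟨y + z, (smul_add _ _ _).symm⟩
  zero_mem' := ⟨0, (smul_zero _).symm⟩
  smul_mem' := by
    rintro c _ ⟨y, rfl⟩
    exact ⟨c * y, by simp⟩

instance hIdeal_isTwoSided (n : ℕ) : (hIdeal A n).IsTwoSided where
  mul_mem_of_left := by
    rintro _ b ⟨y, rfl⟩
    exact ⟨y * b, by simp⟩

/-- The `ħ`-adic completion `lim_n A / ħⁿ A` of a `ℂ⟦ħ⟧`-algebra `A`, as an algebra: the families
of residue classes such that, for every `n`, the members of index at most `n` are the classes of
one element of `A`. -/
def hCompletion : Subalgebra Kh (∀ n : ℕ, A ⧸ hIdeal A n) where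
  carrier := {x | ∀ n, ∃ a : A, ∀ m ≤ n, x m = Ideal.Quotient.mk (hIdeal A m) a}
  mul_mem' := by
    intro x y hx hy n
    obtain ⟨a, ha⟩ := hx n
    obtain ⟨b, hb⟩ := hy n
    exact ⟨a * b, fun m hm => by rw [Pi.mul_apply, ha m hm, hb m hm, map_mul]⟩
  add_mem' := by
    intro x y hx hy n
    obtain ⟨a, ha⟩ := hx n
    obtain ⟨b, hb⟩ := hy n
    exact ⟨a + b, fun m hm => by rw [Pi.add_apply, ha m hm, hb m hm, map_add]⟩
  algebraMap_mem' := fun r _ => ⟨algebraMap Kh A r, fun _ _ => rfl⟩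

/-- The type of elements of the `ħ`-adic completion. -/
abbrev HC : Type _ := hCompletion A

variable {A}
variable {B : Type*} [Ring B] [Algebra Kh B]
variable {C : Type*} [Ring C] [Algebra Kh C]
variable {D : Type*} [Ring D] [Algebra Kh D]

namespace HC

/-- The canonical map from an algebra to its completion. -/
def of : A →ₐ[Kh] HC A where
  toFun a := ⟨fun n => Ideal.Quotient.mk (hIdeal A n) a, fun _ => ⟨a, fun _ _ => rfl⟩⟩
  map_one' := rfl
  map_mul' _ _ := rfl
  map_zero' := rfl
  map_add' _ _ := rfl
  commutes' _ := rfl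

/-- The component of index `n` of an element of the completion. -/
def eval (n : ℕ) : HC A →ₗ[Kh] A ⧸ hIdeal A n where
  toFun x := x.1 n
  map_add' _ _ := rfl
  map_smul' _ _ := rfl

theorem mk_hbar_pow_smul (n : ℕ) (a : A) :
    Ideal.Quotient.mk (hIdeal A n) (hbar ^ n • a) = 0 :=
  Ideal.Quotient.eq_zero_iff_mem.2 ⟨a, rfl⟩

theorem hbar_pow_smul_quotient (n : ℕ) (x : A ⧸ hIdeal A n) : hbar ^ n • x = 0 := by
  obtain ⟨a, rfl⟩ := Ideal.Quotient.mk_surjective x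
  exact mk_hbar_pow_smul n a

theorem mk_eq_of_le {m n : ℕ} (hmn : m ≤ n) {a b : A}
    (h : Ideal.Quotient.mk (hIdeal A n) a = Ideal.Quotient.mk (hIdeal A n) b) :
    Ideal.Quotient.mk (hIdeal A m) a = Ideal.Quotient.mk (hIdeal A m) b := by
  rw [Ideal.Quotient.eq] at h ⊢
  obtain ⟨y, hy⟩ := h
  exact ⟨hbar ^ (n - m) • y, by rw [hy, smul_smul, ← pow_add, Nat.add_sub_cancel' hmn]⟩

/-- A linear map into a completion, modulo `ħⁿ`. -/
def levelMap (f : A →ₗ[Kh] HC B) (n : ℕ) : (A ⧸ hIdeal A n) →+ (B ⧸ hIdeal B n) :=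
  QuotientAddGroup.lift (hIdeal A n).toAddSubgroup
    ((eval n).comp f).toAddMonoidHom (by
      rintro _ ⟨y, rfl⟩
      change eval n (f (hbar ^ n • y)) = 0
      rw [map_smul, map_smul, hbar_pow_smul_quotient])

theorem levelMap_mk (f : A →ₗ[Kh] HC B) (n : ℕ) (a : A) :
    levelMap f n (Ideal.Quotient.mk (hIdeal A n) a) = eval n (f a) := rfl

/-- The unique extension of a `ℂ⟦ħ⟧`-linear map `A → B̂` to a linear map `Â → B̂`. -/
def lift (f : A →ₗ[Kh] HC B) : HC A →ₗ[Kh] HC B where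
  toFun x := ⟨fun n => levelMap f n (x.1 n), by
    intro n
    obtain ⟨a, ha⟩ := x.2 n
    obtain ⟨b, hb⟩ := (f a).2 n
    exact ⟨b, fun m hm => by
      change levelMap f m (x.1 m) = _
      rw [ha m hm, levelMap_mk]
      exact hb m hm⟩⟩
  map_add' x y := Subtype.ext (funext fun n => map_add (levelMap f n) (x.1 n) (y.1 n))
  map_smul' r x := Subtype.ext (funext fun n => by
    change levelMap f n (r • x.1 n) = r • levelMap f n (x.1 n)
    obtain ⟨a, ha⟩ := Ideal.Quotient.mk_surjective (x.1 n)
    rw [← ha]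
    change eval n (f (r • a)) = r • eval n (f a)
    rw [map_smul, map_smul])

theorem lift_of (f : A →ₗ[Kh] HC B) (a : A) : lift f (of a) = f a := rfl

/-- The completion of a linear map. -/
def map (f : A →ₗ[Kh] B) : HC A →ₗ[Kh] HC B := lift (of.toLinearMap ∘ₗ f)

/-- The convergent series `∑ₙ ħⁿ sₙ`. -/
def series (s : ℕ → A) : HC A :=
  ⟨fun n => Ideal.Quotient.mk (hIdeal A n) (∑ m ∈ Finset.range n, hbar ^ m • s m), by
    intro n
    refine ⟨∑ m ∈ Finset.range n, hbar ^ m • s m, fun k hk => ?_⟩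
    rw [← Finset.sum_range_add_sum_Ico _ hk, map_add, map_sum _ _ (Finset.Ico k n)]
    rw [Finset.sum_eq_zero (s := Finset.Ico k n), add_zero]
    intro m hm
    have hkm := (Finset.mem_Ico.1 hm).1
    exact Ideal.Quotient.eq_zero_iff_mem.2 ⟨hbar ^ (m - k) • s m, by
      rw [smul_smul, ← pow_add, Nat.add_sub_cancel' hkm]⟩⟩

/-- `q^x = exp (ħ x) = ∑ₙ ħⁿ xⁿ / n!`. -/
def qpow (x : A) : HC A :=
  series fun n => PowerSeries.C (PowerSeries.coeff n qK) • x ^ n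

/-- `(q^x - q^{-x}) / ħ = ∑ₙ cₙ₊₁ ħⁿ xⁿ⁺¹`, where `cₙ` is the coefficient of `ħⁿ` in `q - q⁻¹`. -/
def qdiff (x : A) : HC A :=
  series fun n => PowerSeries.C (PowerSeries.coeff (n + 1) (qK - qKinv)) • x ^ (n + 1)

theorem hbar_smul_qdiff (x : A) : hbar • qdiff x = qpow x - qpow (-x) := by
  refine Subtype.ext (funext fun n => ?_)
  change Ideal.Quotient.mk (hIdeal A n) (hbar • ∑ m ∈ Finset.range n, hbar ^ m •
      PowerSeries.C (PowerSeries.coeff (m + 1) (qK - qKinv)) • x ^ (m + 1)) =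
    Ideal.Quotient.mk (hIdeal A n) (∑ m ∈ Finset.range n, hbar ^ m •
      PowerSeries.C (PowerSeries.coeff m qK) • x ^ m) -
    Ideal.Quotient.mk (hIdeal A n) (∑ m ∈ Finset.range n, hbar ^ m •
      PowerSeries.C (PowerSeries.coeff m qK) • (-x) ^ m)
  have key : ∀ m, hbar ^ m • PowerSeries.C (PowerSeries.coeff m qK) • x ^ m -
      hbar ^ m • PowerSeries.C (PowerSeries.coeff m qK) • (-x) ^ m =
      hbar ^ m • PowerSeries.C (PowerSeries.coeff m (qK - qKinv)) • x ^ m := by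
    intro m
    rw [← smul_sub, map_sub, map_sub, sub_smul]
    congr 2
    rw [neg_pow, qKinv, PowerSeries.evalNegHom, PowerSeries.coeff_rescale, map_mul, mul_comm,
      mul_smul, ← qK]
    congr 1
    rcases Nat.even_or_odd m with h | h <;> simp [h.neg_one_pow]
  rw [← map_sub, ← Finset.sum_sub_distrib, Finset.sum_congr rfl fun m _ => key m]
  have h0 : PowerSeries.coeff 0 (qK - qKinv) = 0 := by
    rw [map_sub, qKinv, PowerSeries.evalNegHom, PowerSeries.coeff_rescale, qK]
    simp
  have hs := Finset.sum_range_succ' (fun m => hbar ^ m •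
    PowerSeries.C (PowerSeries.coeff m (qK - qKinv)) • x ^ m) n
  rw [h0, map_zero, zero_smul, smul_zero, add_zero, Finset.sum_range_succ] at hs
  rw [Finset.smul_sum, Finset.sum_congr rfl fun m _ =>
    show hbar • hbar ^ m • PowerSeries.C (PowerSeries.coeff (m + 1) (qK - qKinv)) • x ^ (m + 1) =
      hbar ^ (m + 1) • PowerSeries.C (PowerSeries.coeff (m + 1) (qK - qKinv)) • x ^ (m + 1) by
      rw [smul_smul, ← pow_succ'], ← hs, map_add, mk_hbar_pow_smul, add_zero]

/-- The completed tensor product `A ⊗̂ B`. -/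
abbrev Tensor (A B : Type*) [Ring A] [Algebra Kh A] [Ring B] [Algebra Kh B] : Type _ :=
  HC (A ⊗[Kh] B)

/-- The completed tensor product `f ⊗̂ g : A ⊗̂ B → C ⊗̂ D` of two linear maps `f : A → Ĉ` and
`g : B → D̂`; it sends `a ⊗ b` to `(f a ⊗ 1) (1 ⊗ g b)`. -/
def tensorMap (f : A →ₗ[Kh] HC C) (g : B →ₗ[Kh] HC D) : Tensor A B →ₗ[Kh] Tensor C D :=
  lift (TensorProduct.lift ((LinearMap.mul Kh (Tensor C D)).compl₁₂
    (map (Algebra.TensorProduct.includeLeft (R := Kh) (S := Kh) (A := C) (B := D)).toLinearMap ∘ₗ f)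
    (map (Algebra.TensorProduct.includeRight (R := Kh) (A := C) (B := D)).toLinearMap ∘ₗ g)))

/-- The completed multiplication `A ⊗̂ A → Â`. -/
def mul : Tensor A A →ₗ[Kh] HC A := map (LinearMap.mul' Kh A)

end HC

/-- The closure, in the `ħ`-adic topology, of the subalgebra generated by a set: the elements that
agree with a member of the generated subalgebra modulo every power of `ħ`. -/
def closedAdjoin (s : Set A) : Subalgebra Kh A where
  carrier := {x | ∀ n, ∃ y ∈ Algebra.adjoin Kh s, x - y ∈ hIdeal A n}
  mul_mem' := by
    intro x x' hx hx' n
    obtain ⟨y, hy, hxy⟩ := hx n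
    obtain ⟨y', hy', hxy'⟩ := hx' n
    refine ⟨y * y', mul_mem hy hy', ?_⟩
    have h : x * x' - y * y' = (x - y) * x' + y * (x' - y') := by noncomm_ring
    rw [h]
    exact add_mem (Ideal.mul_mem_right _ _ hxy) (Ideal.mul_mem_left _ _ hxy')
  add_mem' := by
    intro x x' hx hx' n
    obtain ⟨y, hy, hxy⟩ := hx n
    obtain ⟨y', hy', hxy'⟩ := hx' n
    refine ⟨y + y', add_mem hy hy', ?_⟩
    rw [add_sub_add_comm]
    exact add_mem hxy hxy'
  algebraMap_mem' := fun r _ => ⟨algebraMap Kh A r, Subalgebra.algebraMap_mem _ r, by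
    rw [sub_self]
    exact zero_mem _⟩

/-! ### Topological Hopf algebras, twists, Hopf subalgebras -/

variable (A) in
/-- A topological Hopf algebra structure over `ℂ⟦ħ⟧` on the algebra `A`: the coproduct takes its
values in the completed tensor square. -/
structure TopHopf where
  /-- the coproduct -/
  comul : A →ₐ[Kh] HC.Tensor A A
  /-- the counit -/
  counit : A →ₐ[Kh] Kh
  /-- the antipode -/
  antipode : A →ₗ[Kh] A
  coassoc : ∀ a : A,
    HC.map (TensorProduct.assoc Kh A A A).toLinearMap
      (HC.tensorMap comul.toLinearMap HC.of.toLinearMap (comul a)) =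
    HC.tensorMap HC.of.toLinearMap comul.toLinearMap (comul a)
  counit_left : ∀ a : A,
    HC.map (TensorProduct.lid Kh A).toLinearMap
      (HC.tensorMap (HC.of.toLinearMap ∘ₗ counit.toLinearMap) HC.of.toLinearMap (comul a)) =
    HC.of a
  counit_right : ∀ a : A,
    HC.map (TensorProduct.rid Kh A).toLinearMap
      (HC.tensorMap HC.of.toLinearMap (HC.of.toLinearMap ∘ₗ counit.toLinearMap) (comul a)) =
    HC.of a
  antipode_left : ∀ a : A,
    HC.mul (HC.tensorMap (HC.of.toLinearMap ∘ₗ antipode) HC.of.toLinearMap (comul a)) =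
    algebraMap Kh (HC A) (counit a)
  antipode_right : ∀ a : A,
    HC.mul (HC.tensorMap HC.of.toLinearMap (HC.of.toLinearMap ∘ₗ antipode) (comul a)) =
    algebraMap Kh (HC A) (counit a)

namespace TopHopf

/-- `HF` is the twist of the Hopf algebra `H` by the invertible element `F`: same algebra, same
counit, coproduct `F Δ(a) F⁻¹` (the antipode of `HF` is then determined by these data). -/
structure IsTwist (H : TopHopf A) (F : HC.Tensor A A) (HF : TopHopf A) : Prop where
  isUnit : IsUnit F
  comul_mul : ∀ a, HF.comul a * F = F * H.comul a
  counit_eq : HF.counit = H.counit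

/-- A subalgebra `S` is a Hopf subalgebra if `Δ(S)` lies in (the image in `A ⊗̂ A` of) the completed
tensor square `S ⊗̂ S` and the antipode preserves `S`. -/
structure IsHopfSubalgebra (H : TopHopf A) (S : Subalgebra Kh A) : Prop where
  comul_mem : ∀ a ∈ S, H.comul a ∈
    LinearMap.range (HC.map (A := S ⊗[Kh] S) (B := A ⊗[Kh] A)
      (TensorProduct.map S.val.toLinearMap S.val.toLinearMap))
  antipode_mem : ∀ a ∈ S, H.antipode a ∈ S

end TopHopf

end Completion

/-! ### The quantized enveloping algebra `U_q(𝔰𝔩_{N+1})` -/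

/-- The Cartan subalgebra `𝔥` of `𝔰𝔩_{N+1}`, in coordinates with respect to its basis
`h_{α_1}, …, h_{α_N}`. -/
abbrev Cartan (N : ℕ) : Type := Fin N → ℂ

/-- The coroot `h_{α_i}`. -/
def coroot {N : ℕ} (i : Fin N) : Cartan N := Pi.single i 1

/-- The Chevalley generators: `h i`, `e i`, `f i` stand for `h_{α_i}`, `e_{α_i}`, `e_{-α_i}`, where
the index `0` stands for the first simple root. -/
inductive Gen (N : ℕ) : Type
  | h : Fin N → Gen N
  | e : Fin N → Gen N
  | f : Fin N → Gen N

/-- The free algebra on the Chevalley generators. -/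
abbrev FreeGen (N : ℕ) : Type := FreeAlgebra Kh (Gen N)

/-- The element of the free algebra given by an element of the Cartan subalgebra. -/
def freeCartan {N : ℕ} (x : Cartan N) : FreeGen N :=
  ∑ i, PowerSeries.C (x i) • FreeAlgebra.ι Kh (Gen.h i)

/-- The generator `e_{α_i}` in the completed free algebra. -/
def genE {N : ℕ} (i : Fin N) : HC (FreeGen N) := HC.of (FreeAlgebra.ι Kh (Gen.e i))

/-- The generator `e_{-α_i}` in the completed free algebra. -/
def genF {N : ℕ} (i : Fin N) : HC (FreeGen N) := HC.of (FreeAlgebra.ι Kh (Gen.f i))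

/-- The element of `𝔥` in the completed free algebra. -/
def genH {N : ℕ} (x : Cartan N) : HC (FreeGen N) := HC.of (freeCartan x)

/-- `(q - q⁻¹) / ħ`, a unit of `ℂ⟦ħ⟧`. -/
def qdiffK : Kh := PowerSeries.mk fun n => PowerSeries.coeff (n + 1) (qK - qKinv)

theorem hbar_mul_qdiffK : hbar * qdiffK = qK - qKinv := by
  ext n
  cases n with
  | zero =>
    rw [map_sub, qKinv, PowerSeries.evalNegHom, PowerSeries.coeff_rescale, qK]
    simp
  | succ n => rw [PowerSeries.coeff_succ_X_mul, qdiffK, PowerSeries.coeff_mk]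

theorem isUnit_qdiffK : IsUnit qdiffK := by
  rw [PowerSeries.isUnit_iff_constantCoeff, ← PowerSeries.coeff_zero_eq_constantCoeff_apply,
    qdiffK, PowerSeries.coeff_mk, map_sub, qKinv, PowerSeries.evalNegHom,
    PowerSeries.coeff_rescale, qK, PowerSeries.coeff_exp]
  norm_num

/-- The defining relations of `U_q(𝔰𝔩_{N+1})` (pairs of elements to be identified). The relation
`[e_{α_i}, e_{-α_j}] = δ_{ij} (q^{h_{α_i}} - q^{-h_{α_i}}) / (q - q⁻¹)` is multiplied by the unit
`(q - q⁻¹) / ħ`. -/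
inductive UqRel (N : ℕ) : HC (FreeGen N) → HC (FreeGen N) → Prop
  | hh (i j : Fin N) : UqRel N (genH (coroot i) * genH (coroot j) - genH (coroot j) * genH (coroot i)) 0
  | he (i j : Fin N) : UqRel N (genH (coroot i) * genE j - genE j * genH (coroot i))
      (CartanMatrix.A N i j • genE j)
  | hf (i j : Fin N) : UqRel N (genH (coroot i) * genF j - genF j * genH (coroot i))
      (-(CartanMatrix.A N i j • genF j))
  | ef_same (i : Fin N) : UqRel N (qdiffK • (genE i * genF i - genF i * genE i))
      (HC.qdiff (freeCartan (coroot i)))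
  | ef_ne (i j : Fin N) (hij : i ≠ j) : UqRel N (genE i * genF j - genF j * genE i) 0
  | serre_e (i j : Fin N) (hij : i.val + 1 = j.val ∨ j.val + 1 = i.val) :
      UqRel N (genE i ^ 2 * genE j - (qK + qKinv) • (genE i * genE j * genE i)
        + genE j * genE i ^ 2) 0
  | serre_f (i j : Fin N) (hij : i.val + 1 = j.val ∨ j.val + 1 = i.val) :
      UqRel N (genF i ^ 2 * genF j - (qK + qKinv) • (genF i * genF j * genF i)
        + genF j * genF i ^ 2) 0
  | comm_e (i j : Fin N) (hij : ¬(i.val + 1 = j.val ∨ j.val + 1 = i.val)) :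
      UqRel N (genE i * genE j - genE j * genE i) 0
  | comm_f (i j : Fin N) (hij : ¬(i.val + 1 = j.val ∨ j.val + 1 = i.val)) :
      UqRel N (genF i * genF j - genF j * genF i) 0

/-- The closure of the two-sided ideal generated by the defining relations. -/
def relIdeal (N : ℕ) : TwoSidedIdeal (HC (FreeGen N)) :=
  ⨅ n : ℕ, TwoSidedIdeal.span
    ({x | ∃ a b, UqRel N a b ∧ x = a - b} ∪ {algebraMap Kh (HC (FreeGen N)) (hbar ^ n)})

/-- The quantized enveloping algebra `U_q(𝔰𝔩_{N+1})` over `ℂ⟦ħ⟧`, `q = exp ħ`: the algebra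
topologically generated by the Chevalley generators, subject to the defining relations. -/
def Uq (N : ℕ) : Type := HC (FreeGen N) ⧸ (relIdeal N).asIdeal

namespace Uq

variable {N : ℕ}

instance : Ring (Uq N) := inferInstanceAs (Ring (HC (FreeGen N) ⧸ (relIdeal N).asIdeal))

instance : Algebra Kh (Uq N) :=
  inferInstanceAs (Algebra Kh (HC (FreeGen N) ⧸ (relIdeal N).asIdeal))

/-- The projection from the completed free algebra. -/
def mk : HC (FreeGen N) →ₐ[Kh] Uq N := Ideal.Quotient.mkₐ Kh (relIdeal N).asIdeal

/-- The generator `e_{α_i}`. -/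
def E (i : Fin N) : Uq N := mk (genE i)

/-- The generator `e_{-α_i}`. -/
def F (i : Fin N) : Uq N := mk (genF i)

/-- The element of `U_q` given by an element of the Cartan subalgebra. -/
def H (x : Cartan N) : Uq N := mk (genH x)

/-- The element `q^x` of `U_q` for `x` in the Cartan subalgebra. -/
def qH (x : Cartan N) : Uq N := mk (HC.qpow (freeCartan x))

/-- The element of `U_q ⊗ U_q` given by an element of `𝔥 ⊗ 𝔥`. -/
def HH (r : Cartan N ⊗[ℂ] Cartan N) : Uq N ⊗[Kh] Uq N :=
  ∑ i, ∑ j, PowerSeries.C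
    (((Pi.basisFun ℂ (Fin N)).tensorProduct (Pi.basisFun ℂ (Fin N))).repr r (i, j)) •
      (H (coroot i) ⊗ₜ[Kh] H (coroot j))

/-- The standard Hopf algebra structure of `U_q(𝔰𝔩_{N+1})`, given by its values on generators. -/
structure IsStandard (𝓗 : TopHopf (Uq N)) : Prop where
  comul_h : ∀ i, 𝓗.comul (H (coroot i)) = HC.of (H (coroot i) ⊗ₜ 1 + 1 ⊗ₜ H (coroot i))
  comul_e : ∀ i, 𝓗.comul (E i) = HC.of (qH (-coroot i) ⊗ₜ E i + E i ⊗ₜ 1)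
  comul_f : ∀ i, 𝓗.comul (F i) = HC.of (F i ⊗ₜ qH (coroot i) + 1 ⊗ₜ F i)
  antipode_h : ∀ i, 𝓗.antipode (H (coroot i)) = -H (coroot i)
  antipode_e : ∀ i, 𝓗.antipode (E i) = -(qH (coroot i) * E i)
  antipode_f : ∀ i, 𝓗.antipode (F i) = -(F i * qH (-coroot i))
  counit_h : ∀ i, 𝓗.counit (H (coroot i)) = 0
  counit_e : ∀ i, 𝓗.counit (E i) = 0
  counit_f : ∀ i, 𝓗.counit (F i) = 0

end Uq

/-! ### The Cartan part of the Cremmer–Gervais `r`-matrix -/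

/-- The simple root `α_i` as a linear form on the Cartan subalgebra. -/
def simpleRoot {N : ℕ} (i : Fin N) : Cartan N →ₗ[ℂ] ℂ :=
  ∑ j, (CartanMatrix.A N i j : ℂ) • LinearMap.proj j

/-- The Cartan part `Ω₀` of the quadratic Casimir element of `𝔰𝔩_{N+1}`, for the invariant form
with `(α_i, α_i) = 2`. -/
def casimirCartan (N : ℕ) : Cartan N ⊗[ℂ] Cartan N :=
  ∑ i, ∑ j, ((CartanMatrix.A N).map (Int.cast : ℤ → ℂ))⁻¹ i j • (coroot i ⊗ₜ[ℂ] coroot j)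

/-- The equations for the Cartan part of an `r`-matrix attached to the Belavin–Drinfeld triple of
Cremmer–Gervais type, `τ(α_i) = α_{i+1}` for `1 ≤ i ≤ N - 1`:
`r + r²¹ = Ω₀` and `(τ(α) ⊗ 1 + 1 ⊗ α)(r) = 0` for `α = α_1, …, α_{N-1}`. -/
structure IsCremmerGervaisCartanPart {N : ℕ} (r : Cartan N ⊗[ℂ] Cartan N) : Prop where
  add_swap : r + TensorProduct.comm ℂ (Cartan N) (Cartan N) r = casimirCartan N
  shift : ∀ i j : Fin N, i.val + 1 = j.val →
    TensorProduct.lid ℂ (Cartan N) (TensorProduct.map (simpleRoot j) LinearMap.id r) +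
      TensorProduct.rid ℂ (Cartan N) (TensorProduct.map LinearMap.id (simpleRoot i) r) = 0

/-- The tensor `r₀(5)`. -/
def r05 : Cartan 4 ⊗[ℂ] Cartan 4 :=
  let h₁ : Cartan 4 := coroot 0
  let h₂ : Cartan 4 := coroot 1
  let h₃ : Cartan 4 := coroot 2
  let h₄ : Cartan 4 := coroot 3
  h₁ ⊗ₜ ((2 / 5 : ℂ) • h₁ + (3 / 5 : ℂ) • h₂ + (3 / 5 : ℂ) • h₃ + (2 / 5 : ℂ) • h₄)
    + h₂ ⊗ₜ ((3 / 5 : ℂ) • h₂ + (4 / 5 : ℂ) • h₃ + (3 / 5 : ℂ) • h₄)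
    + h₃ ⊗ₜ (-(1 / 5 : ℂ) • h₁ + (3 / 5 : ℂ) • h₃ + (3 / 5 : ℂ) • h₄)
    + h₄ ⊗ₜ (-(1 / 5 : ℂ) • h₁ - (1 / 5 : ℂ) • h₂ + (2 / 5 : ℂ) • h₄)

/-- The element `p₅` of the Cartan subalgebra of `𝔰𝔩₅`. -/
def p5 : Cartan 4 :=
  (3 / 5 : ℂ) • coroot 0 + (1 / 5 : ℂ) • coroot 1 - (1 / 5 : ℂ) • coroot 2
    - (3 / 5 : ℂ) • coroot 3

/-- The quantum seaweed algebra `U_q(SW'₅)`: the subalgebra of `U_q(𝔰𝔩₅)` topologically generated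
by `h_{α_2}`, `h_{α_3}`, `p₅`, `e_{-α_1}`, `e_{α_4}`, `e_{±α_2}`, `e_{±α_3}`. It consists of the
values of all series `∑ₙ ħⁿ Pₙ`, where the `Pₙ` are noncommutative polynomials in these elements. -/
def UqSW5 : Subalgebra Kh (Uq 4) :=
  (closedAdjoin {genH (coroot 1), genH (coroot 2), genH p5, genF 0, genE 3,
    genE 1, genF 1, genE 2, genF 2}).map Uq.mk

/-- The element `𝒦₅ = q^{r₀(5)}` of `U_q(𝔰𝔩₅) ⊗̂ U_q(𝔰𝔩₅)`. -/
def K5 : HC.Tensor (Uq 4) (Uq 4) := HC.qpow (Uq.HH r05)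

end

/-! For $r\in\mathfrak h\otimes\mathfrak h$ and $g$ of weight $\lambda$, conjugation by $q^r$ sends
$1\otimes g$ to $q^{(1\otimes\lambda)(r)}\otimes g$ and $g\otimes1$ to $g\otimes
q^{(\lambda\otimes1)(r)}$, and it fixes $\mathfrak h\otimes1$ and $1\otimes\mathfrak h$. Put
$b_j=(\alpha_j\otimes1)(r_0(5))$. Contracting $r+r^{21}=\Omega_0$ with $\alpha_j$ gives
$(1\otimes\alpha_j)(r)=h_{\alpha_j}-b_j$, so the twisted coproduct is $e_{\alpha_j}\mapsto
q^{-b_j}\otimes e_{\alpha_j}+e_{\alpha_j}\otimes q^{b_j}$ and $e_{-\alpha_j}\mapsto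
e_{-\alpha_j}\otimes q^{h_{\alpha_j}-b_j}+q^{-(h_{\alpha_j}-b_j)}\otimes e_{-\alpha_j}$.

The shift equations say $h_{\alpha_j}-b_j=-b_{j+1}$ for $j\le3$. Hence the generators
$e_{\alpha_2},e_{\alpha_3},e_{\alpha_4}$ and $e_{-\alpha_1},e_{-\alpha_2},e_{-\alpha_3}$ only
involve $q^{\pm b_2},q^{\pm b_3},q^{\pm b_4}$, and $b_2,b_3,b_4$ lie in the span of
$h_{\alpha_2},h_{\alpha_3},p_5$ (`contrRoot_mem`, `coroot_sub_contrRoot_mem`). Since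
$\alpha_j(b_j)=\frac12(\alpha_j,\alpha_j)=1$, the twisted antipode multiplies $e_{\alpha_j}$ by $-q$
and $e_{-\alpha_j}$ by $-q^{-1}$, so it visibly preserves the subalgebra.

Both Hopf structures come from one construction, `hopfOfSkewPrimitive`: any algebra homomorphism
making the $h_{\alpha_i}$ primitive and the $e_{\pm\alpha_i}$ skew primitive yields a topological
Hopf algebra, provided the expected antipode exists. No cocycle identity for the twist is needed.
Existence of the homomorphisms rests on the universal property `Uq.lift`, with the relations checked
in `comul_relations` and `antipode_relations`. The twisted coproduct is the standard one followed by
conjugation (`exists_twist`).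

Membership of $\Delta(a)$ in the image of the completed tensor square is obtained by lifting to the
completed free algebra (`comul_mem_seaweed`), which avoids asking whether that image is closed. -/

noncomputable section

/-! ### Convergent series and exponentials in $\hbar$-adically complete algebras. -/

section HAdic

/-- `x` is the sum of the series `∑ ħᵐ sₘ`. -/
def IsHSum {A : Type*} [Ring A] [Algebra Kh A] (s : ℕ → A) (x : A) : Prop :=
  ∀ n, ∃ y, x = ∑ m ∈ Finset.range n, hbar ^ m • s m + hbar ^ n • y

/-- A `ℂ⟦ħ⟧`-algebra is `ħ`-adically complete and separated. -/
class HComplete (A : Type*) [Ring A] [Algebra Kh A] : Prop where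
  eq_zero : ∀ x : A, (∀ n, ∃ y, x = hbar ^ n • y) → x = 0
  exists_sum : ∀ s : ℕ → A, ∃ x, IsHSum s x

variable {A : Type*} [Ring A] [Algebra Kh A]
variable {B : Type*} [Ring B] [Algebra Kh B]
variable {T : Type*} [Ring T] [Algebra Kh T] [HComplete T]

namespace HComplete

theorem eq_of_forall {x x' : T} (h : ∀ n, ∃ y, x - x' = hbar ^ n • y) : x = x' :=
  sub_eq_zero.1 (eq_zero _ h)

end HComplete

namespace IsHSum

theorem unique {s : ℕ → T} {x x' : T} (h : IsHSum s x) (h' : IsHSum s x') : x = x' := by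
  refine HComplete.eq_of_forall fun n => ?_
  obtain ⟨y, hy⟩ := h n
  obtain ⟨y', hy'⟩ := h' n
  exact ⟨y - y', by rw [hy, hy', smul_sub]; abel⟩

/-- Linearity over $\mathbb C[[\hbar]]$ already preserves divisibility by $\hbar^n$, so no
continuity assumption is ever needed. -/
theorem map {s : ℕ → A} {x : A} (h : IsHSum s x) (f : A →ₗ[Kh] B) :
    IsHSum (fun n => f (s n)) (f x) := by
  intro n
  obtain ⟨y, hy⟩ := h n
  exact ⟨f y, by rw [hy]; simp⟩

theorem add {s t : ℕ → A} {x y : A} (hx : IsHSum s x) (hy : IsHSum t y) :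
    IsHSum (fun n => s n + t n) (x + y) := by
  intro n
  obtain ⟨u, hu⟩ := hx n
  obtain ⟨v, hv⟩ := hy n
  exact ⟨u + v, by rw [hu, hv]; simp only [smul_add, Finset.sum_add_distrib]; abel⟩

theorem neg {s : ℕ → A} {x : A} (hx : IsHSum s x) : IsHSum (fun n => -s n) (-x) := by
  intro n
  obtain ⟨u, hu⟩ := hx n
  exact ⟨-u, by rw [hu]; simp only [smul_neg, Finset.sum_neg_distrib]; abel⟩

theorem mul_left {s : ℕ → A} {x : A} (hx : IsHSum s x) (a : A) :
    IsHSum (fun n => a * s n) (a * x) :=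
  hx.map (LinearMap.mulLeft Kh a)

theorem mul_right {s : ℕ → A} {x : A} (hx : IsHSum s x) (a : A) :
    IsHSum (fun n => s n * a) (x * a) :=
  hx.map (LinearMap.mulRight Kh a)

/-- The Cauchy product modulo $\hbar^n$. The induction removes $s_0$ and shifts the rest of $s$,
which is why $s$ is generalized. -/
theorem exists_partial_mul (n : ℕ) (s t : ℕ → A) : ∃ w,
    (∑ m ∈ Finset.range n, hbar ^ m • s m) * (∑ m ∈ Finset.range n, hbar ^ m • t m) =
      ∑ m ∈ Finset.range n, hbar ^ m • (∑ p ∈ Finset.HasAntidiagonal.antidiagonal m, s p.1 * t p.2) +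
        hbar ^ n • w := by
  induction n generalizing s with
  | zero => exact ⟨0, by simp⟩
  | succ n ih =>
    obtain ⟨w, hw⟩ := ih (fun m => s (m + 1))
    -- The second summand is the shifted tail of $s$ times the last term $\hbar^n t_n$; the factor
    -- $\hbar$ in front of the tail brings it to order $n+1$.
    refine ⟨w + (∑ m ∈ Finset.range n, hbar ^ m • s (m + 1)) * t n, ?_⟩
    have h1 : ∑ m ∈ Finset.range (n + 1), hbar ^ m • s m =
        s 0 + hbar • ∑ m ∈ Finset.range n, hbar ^ m • s (m + 1) := by
      rw [Finset.sum_range_succ', Finset.smul_sum, add_comm]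
      simp [smul_smul, pow_succ']
    have h2 : ∑ m ∈ Finset.range (n + 1),
          hbar ^ m • (∑ p ∈ Finset.HasAntidiagonal.antidiagonal m, s p.1 * t p.2) =
        s 0 * (∑ m ∈ Finset.range (n + 1), hbar ^ m • t m) + hbar • ∑ m ∈ Finset.range n,
          hbar ^ m • (∑ p ∈ Finset.HasAntidiagonal.antidiagonal m, s (p.1 + 1) * t p.2) := by
      rw [Finset.sum_range_succ', Finset.sum_range_succ' (fun m => hbar ^ m • t m), mul_add,
        Finset.mul_sum, Finset.smul_sum]
      simp only [Finset.Nat.sum_antidiagonal_succ, smul_add, Finset.sum_add_distrib,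
        mul_smul_comm, pow_succ', mul_smul, Finset.smul_sum, pow_zero, one_smul,
        Finset.Nat.antidiagonal_zero, Finset.sum_singleton]
      exact add_right_comm _ _ _
    rw [h2, h1, add_mul, smul_mul_assoc, Finset.sum_range_succ (fun m => hbar ^ m • t m) n,
      mul_add _ _ (hbar ^ n • t n), mul_add _ _ (hbar ^ n • t n), hw]
    simp only [smul_add, smul_smul, pow_succ', mul_smul_comm]
    abel

theorem mul {s t : ℕ → A} {x y : A} (hx : IsHSum s x) (hy : IsHSum t y) :
    IsHSum (fun n => ∑ p ∈ Finset.HasAntidiagonal.antidiagonal n, s p.1 * t p.2) (x * y) := by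
  intro n
  obtain ⟨u, hu⟩ := hx n
  obtain ⟨v, hv⟩ := hy n
  obtain ⟨w, hw⟩ := exists_partial_mul n s t
  refine ⟨w + (∑ m ∈ Finset.range n, hbar ^ m • s m) * v + u * y, ?_⟩
  conv_lhs => rw [hu, add_mul]
  conv_lhs => enter [1]; rw [hv, mul_add, hw]
  simp only [smul_add, mul_smul_comm, smul_mul_assoc]
  abel

end IsHSum

/-- The sum of the series `∑ ħᵐ sₘ`. -/
def hsum (s : ℕ → T) : T := (HComplete.exists_sum s).choose

theorem isHSum_hsum (s : ℕ → T) : IsHSum s (hsum s) := (HComplete.exists_sum s).choose_spec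

theorem coeff_qK (n : ℕ) : PowerSeries.coeff n qK = (n.factorial : ℂ)⁻¹ := by
  simp [qK, PowerSeries.coeff_exp]

theorem coeff_qKinv (n : ℕ) : PowerSeries.coeff n qKinv = (-1) ^ n * (n.factorial : ℂ)⁻¹ := by
  rw [qKinv, PowerSeries.evalNegHom, PowerSeries.coeff_rescale, ← coeff_qK, qK]

/-- The terms of the exponential series. -/
def expTerm (x : A) (n : ℕ) : A := PowerSeries.C (PowerSeries.coeff n qK) • x ^ n

/-- The terms of the series of `(q^x - q^{-x}) / ħ`. -/
def qdiffTerm (x : A) (n : ℕ) : A :=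
  PowerSeries.C (PowerSeries.coeff (n + 1) (qK - qKinv)) • x ^ (n + 1)

/-- `exp (ħ x)` in a complete algebra. -/
def hexp (x : T) : T := hsum (expTerm x)

/-- `(exp (ħ x) - exp (-ħ x)) / ħ` in a complete algebra. -/
def hqdiff (x : T) : T := hsum (qdiffTerm x)

theorem isHSum_hexp (x : T) : IsHSum (expTerm x) (hexp x) := isHSum_hsum _

theorem isHSum_hqdiff (x : T) : IsHSum (qdiffTerm x) (hqdiff x) := isHSum_hsum _

theorem map_expTerm (f : A →ₐ[Kh] B) (x : A) (n : ℕ) : f (expTerm x n) = expTerm (f x) n := by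
  simp [expTerm]

theorem map_qdiffTerm (f : A →ₐ[Kh] B) (x : A) (n : ℕ) :
    f (qdiffTerm x n) = qdiffTerm (f x) n := by
  simp [qdiffTerm]

theorem map_eq_hexp (f : A →ₐ[Kh] T) {x y : A} (h : IsHSum (expTerm x) y) :
    f y = hexp (f x) := by
  have := h.map f.toLinearMap
  simp only [AlgHom.toLinearMap_apply, map_expTerm] at this
  exact this.unique (isHSum_hexp _)

theorem map_eq_hqdiff (f : A →ₐ[Kh] T) {x y : A} (h : IsHSum (qdiffTerm x) y) :
    f y = hqdiff (f x) := by
  have := h.map f.toLinearMap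
  simp only [AlgHom.toLinearMap_apply, map_qdiffTerm] at this
  exact this.unique (isHSum_hqdiff _)

theorem map_hexp {T' : Type*} [Ring T'] [Algebra Kh T'] [HComplete T'] (f : T →ₐ[Kh] T') (x : T) :
    f (hexp x) = hexp (f x) :=
  map_eq_hexp f (isHSum_hexp x)

theorem map_hqdiff {T' : Type*} [Ring T'] [Algebra Kh T'] [HComplete T'] (f : T →ₐ[Kh] T')
    (x : T) : f (hqdiff x) = hqdiff (f x) :=
  map_eq_hqdiff f (isHSum_hqdiff x)

theorem hexp_zero : hexp (0 : T) = 1 := by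
  refine (isHSum_hexp 0).unique fun n => ?_
  cases n with
  | zero => exact ⟨1, by simp⟩
  | succ n => exact ⟨0, by rw [Finset.sum_range_succ']; simp [expTerm, coeff_qK]⟩

theorem hqdiff_zero : hqdiff (0 : T) = 0 :=
  (isHSum_hqdiff 0).unique fun n => ⟨0, by simp [qdiffTerm]⟩

theorem hqdiff_neg (x : T) : hqdiff (-x) = -hqdiff x := by
  refine (isHSum_hqdiff (-x)).unique ?_
  convert (isHSum_hqdiff x).neg using 2 with n
  rw [qdiffTerm, qdiffTerm, map_sub, coeff_qK, coeff_qKinv]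
  rcases Nat.even_or_odd (n + 1) with h | h <;> simp [h.neg_one_pow, h.neg_pow]

theorem C_smul_pow_mul {x y : A} (c d : ℂ) (i j : ℕ) :
    (PowerSeries.C c • x ^ i) * (PowerSeries.C d • y ^ j) =
      PowerSeries.C (c * d) • (x ^ i * y ^ j) := by
  rw [smul_mul_smul_comm, map_mul]

theorem add_pow_antidiagonal {x y : A} (h : Commute x y) (n : ℕ) :
    (x + y) ^ n = ∑ p ∈ Finset.HasAntidiagonal.antidiagonal n,
      PowerSeries.C (n.choose p.1 : ℂ) • (x ^ p.1 * y ^ p.2) := by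
  rw [h.add_pow']
  refine Finset.sum_congr rfl fun p _ => ?_
  rw [map_natCast, Nat.cast_smul_eq_nsmul]

theorem hexp_add {x y : T} (h : Commute x y) : hexp (x + y) = hexp x * hexp y := by
  refine (isHSum_hexp (x + y)).unique ?_
  convert (isHSum_hexp x).mul (isHSum_hexp y) using 2 with n
  rw [expTerm, add_pow_antidiagonal h, Finset.smul_sum]
  refine Finset.sum_congr rfl fun p hp => ?_
  rw [Finset.HasAntidiagonal.mem_antidiagonal] at hp
  rw [expTerm, expTerm, C_smul_pow_mul, smul_smul, ← map_mul]
  congr 2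
  rw [coeff_qK, coeff_qK, coeff_qK, ← hp, Nat.cast_add_choose]
  have := Nat.factorial_ne_zero (p.1 + p.2)
  field_simp

/-- This is $e^{x+y}-e^{-x-y}=(e^x-e^{-x})e^y+e^{-x}(e^y-e^{-y})$ (with $\hbar$ in the exponents),
divided by $\hbar$. Since `T` may have $\hbar$-torsion, the identity is compared coefficient by
coefficient. It is what makes the coproduct respect $[e_{\alpha_i},e_{-\alpha_i}]$. -/
theorem hqdiff_add {x y : T} (h : Commute x y) :
    hqdiff (x + y) = hqdiff x * hexp y + hexp (-x) * hqdiff y := by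
  refine (isHSum_hqdiff (x + y)).unique ?_
  convert ((isHSum_hqdiff x).mul (isHSum_hexp y)).add
    ((isHSum_hexp (-x)).mul (isHSum_hqdiff y)) using 2 with n
  let c : ℕ → ℂ := fun m => PowerSeries.coeff m (qK - qKinv)
  let e : ℕ → ℂ := fun m => PowerSeries.coeff m qK
  have hc : ∀ m, c m = (1 - (-1) ^ m) * (m.factorial : ℂ)⁻¹ := fun m => by
    simp only [c]; rw [map_sub, coeff_qK, coeff_qKinv]; ring
  -- The constant term of $q-q^{-1}$ vanishes, so a sum over bidegrees of total degree $n$ becomes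
  -- one of total degree $n+1$.
  have h1 : ∑ p ∈ Finset.HasAntidiagonal.antidiagonal n, qdiffTerm x p.1 * expTerm y p.2 =
      ∑ p ∈ Finset.HasAntidiagonal.antidiagonal (n + 1),
        PowerSeries.C (c p.1 * e p.2) • (x ^ p.1 * y ^ p.2) := by
    rw [Finset.Nat.sum_antidiagonal_succ]
    have h0 : c 0 = 0 := by rw [hc]; simp
    simp only [h0, zero_mul, map_zero, zero_smul, zero_add]
    exact Finset.sum_congr rfl fun p _ => C_smul_pow_mul _ _ _ _
  have h2 : ∑ p ∈ Finset.HasAntidiagonal.antidiagonal n, expTerm (-x) p.1 * qdiffTerm y p.2 =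
      ∑ p ∈ Finset.HasAntidiagonal.antidiagonal (n + 1),
        PowerSeries.C ((-1) ^ p.1 * e p.1 * c p.2) • (x ^ p.1 * y ^ p.2) := by
    rw [Finset.Nat.sum_antidiagonal_succ']
    have h0 : c 0 = 0 := by rw [hc]; simp
    simp only [h0, mul_zero, map_zero, zero_smul, zero_add]
    refine Finset.sum_congr rfl fun p _ => ?_
    rw [expTerm, qdiffTerm, C_smul_pow_mul, mul_assoc]
    rcases Nat.even_or_odd p.1 with h | h <;> simp [h.neg_one_pow, h.neg_pow, c, e]
  rw [h1, h2, ← Finset.sum_add_distrib, qdiffTerm, add_pow_antidiagonal h, Finset.smul_sum]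
  refine Finset.sum_congr rfl fun p hp => ?_
  rw [Finset.HasAntidiagonal.mem_antidiagonal] at hp
  rw [smul_smul, ← map_mul, ← add_smul, ← map_add]
  congr 2
  change c (n + 1) * _ = _
  simp only [e]
  rw [hc, hc, hc, coeff_qK, coeff_qK, ← hp, Nat.cast_add_choose, pow_add]
  have := Nat.factorial_ne_zero (p.1 + p.2)
  field_simp
  ring

theorem SemiconjBy.hexp_right {a x y : T} (h : SemiconjBy a x y) :
    SemiconjBy a (hexp x) (hexp y) := by
  have h1 := (isHSum_hexp x).mul_left a
  have h2 := (isHSum_hexp y).mul_right a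
  have : (fun n => a * expTerm x n) = fun n => expTerm y n * a := by
    funext n
    simp only [expTerm, mul_smul_comm, smul_mul_assoc]
    rw [(h.pow_right n).eq]
  rw [this] at h1
  exact h1.unique h2

theorem Commute.hexp_right {a x : T} (h : Commute a x) : Commute a (hexp x) :=
  SemiconjBy.hexp_right h

theorem Commute.hexp_left {a x : T} (h : Commute x a) : Commute (hexp x) a :=
  (Commute.hexp_right h.symm).symm

theorem hexp_mul_hexp_neg (x : T) : hexp x * hexp (-x) = 1 := by
  rw [← hexp_add (Commute.refl x).neg_right, add_neg_cancel, hexp_zero]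

theorem hexp_neg_mul_hexp (x : T) : hexp (-x) * hexp x = 1 := by
  rw [← hexp_add (Commute.refl x).neg_left, neg_add_cancel, hexp_zero]

end HAdic

/-! ### Completions, their universal property, completed tensor products. -/

section Completeness

variable {A : Type*} [Ring A] [Algebra Kh A]
variable {B : Type*} [Ring B] [Algebra Kh B]
variable {C : Type*} [Ring C] [Algebra Kh C]
variable {D : Type*} [Ring D] [Algebra Kh D]
variable {T : Type*} [Ring T] [Algebra Kh T] [HComplete T]

/-- Sums exist in the quotient because a series can be lifted termwise; separatedness does not
descend and has to be supplied. -/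
theorem HComplete.of_surjective (f : A →ₐ[Kh] B) (hf : Function.Surjective f)
    (hA : ∀ s : ℕ → A, ∃ x, IsHSum s x)
    (hB : ∀ x : B, (∀ n, ∃ y, x = hbar ^ n • y) → x = 0) : HComplete B where
  eq_zero := hB
  exists_sum s := by
    choose t ht using fun n => hf (s n)
    obtain ⟨x, hx⟩ := hA t
    refine ⟨f x, ?_⟩
    have := hx.map f.toLinearMap
    simp only [AlgHom.toLinearMap_apply, ht] at this
    exact this

instance : HComplete Kh where
  eq_zero x hx := by
    ext n
    obtain ⟨y, hy⟩ := hx (n + 1)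
    rw [hy, smul_eq_mul, PowerSeries.coeff_X_pow_mul', if_neg (by omega), map_zero]
  exists_sum s := by
    refine ⟨PowerSeries.mk fun k => ∑ m ∈ Finset.range (k + 1),
      PowerSeries.coeff (k - m) (s m), fun n => ?_⟩
    have : (PowerSeries.X : Kh) ^ n ∣ PowerSeries.mk (fun k => ∑ m ∈ Finset.range (k + 1),
      PowerSeries.coeff (k - m) (s m)) - ∑ m ∈ Finset.range n, hbar ^ m • s m := by
      rw [PowerSeries.X_pow_dvd_iff]
      intro k hk
      rw [map_sub, PowerSeries.coeff_mk, map_sum, sub_eq_zero]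
      refine Finset.sum_subset_zero_on_sdiff (Finset.range_mono hk) ?_ ?_
      · intro m hm
        rw [Finset.mem_sdiff, Finset.mem_range, Finset.mem_range] at hm
        rw [smul_eq_mul, PowerSeries.coeff_X_pow_mul', if_neg (by omega)]
      · intro m hm
        rw [Finset.mem_range] at hm
        rw [smul_eq_mul, PowerSeries.coeff_X_pow_mul', if_pos (by omega)]
    obtain ⟨y, hy⟩ := this
    exact ⟨y, by rw [smul_eq_mul, ← hy]; abel⟩

/-- Antipodes are built as algebra homomorphisms into the opposite algebra, to which the universal
property applies only if it is complete. -/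
instance : HComplete Tᵐᵒᵖ where
  eq_zero x hx := by
    rw [← MulOpposite.unop_eq_zero_iff]
    refine HComplete.eq_zero _ fun n => ?_
    obtain ⟨y, hy⟩ := hx n
    exact ⟨y.unop, by rw [hy, MulOpposite.unop_smul]⟩
  exists_sum s := by
    obtain ⟨x, hx⟩ := HComplete.exists_sum fun n => (s n).unop
    refine ⟨MulOpposite.op x, ?_⟩
    exact hx.map (MulOpposite.opLinearEquiv Kh).toLinearMap

theorem op_hexp (x : T) : MulOpposite.op (hexp x) = hexp (MulOpposite.op x) := by
  have := (isHSum_hexp x).map (MulOpposite.opLinearEquiv Kh : T ≃ₗ[Kh] Tᵐᵒᵖ).toLinearMap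
  refine this.unique ?_
  convert isHSum_hexp (MulOpposite.op x) using 2 with n
  simp [expTerm]

theorem op_hqdiff (x : T) : MulOpposite.op (hqdiff x) = hqdiff (MulOpposite.op x) := by
  have := (isHSum_hqdiff x).map (MulOpposite.opLinearEquiv Kh : T ≃ₗ[Kh] Tᵐᵒᵖ).toLinearMap
  refine this.unique ?_
  convert isHSum_hqdiff (MulOpposite.op x) using 2 with n
  simp [qdiffTerm]

namespace HC

theorem isHSum_series (s : ℕ → A) : IsHSum (fun n => of (s n)) (series s) := by
  intro n
  -- The remainder after $n$ terms is $\hbar^n$ times the series shifted by $n$.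
  refine ⟨series fun k => s (n + k), Subtype.ext (funext fun k => ?_)⟩
  have h : of (∑ m ∈ Finset.range n, hbar ^ m • s m) =
      ∑ m ∈ Finset.range n, hbar ^ m • of (s m) := by simp
  rw [← h]
  change Ideal.Quotient.mk (hIdeal A k) (∑ m ∈ Finset.range k, hbar ^ m • s m) =
    Ideal.Quotient.mk (hIdeal A k) (∑ m ∈ Finset.range n, hbar ^ m • s m) +
    Ideal.Quotient.mk (hIdeal A k) (hbar ^ n • ∑ m ∈ Finset.range k, hbar ^ m • s (n + m))
  rw [← map_add, Finset.smul_sum]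
  simp_rw [smul_smul, ← pow_add]
  rw [← Finset.sum_range_add (fun m => hbar ^ m • s m), add_comm n k, Finset.sum_range_add, map_add,
    map_sum _ _ (Finset.range n), Finset.sum_eq_zero (s := Finset.range n), add_zero]
  intro m _
  rw [pow_add, mul_smul, mk_hbar_pow_smul]

/-- Choose representatives $a_k$ with $a_{k+1}-a_k=\hbar^kc_k$ and $a_n=\hbar^nc'$. Then
$a_{n+k}=\hbar^n(c'+\sum_{m<k}\hbar^mc_{n+m})$, and the bracket converges to the quotient. Torsion
does no harm, as nothing is cancelled. -/
theorem exists_eq_smul {n : ℕ} {z : HC A} (hz : z.1 n = 0) : ∃ y, z = hbar ^ n • y := by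
  choose a ha using z.2
  have hc : ∀ k, ∃ c, a (k + 1) - a k = hbar ^ k • c := fun k => by
    have := ha (k + 1) k (by omega)
    rw [ha k k le_rfl, eq_comm, Ideal.Quotient.eq] at this
    exact this
  choose c hc using hc
  obtain ⟨c', hc'⟩ : ∃ c', a n = hbar ^ n • c' := by
    have := ha n n le_rfl
    rw [hz, eq_comm, Ideal.Quotient.eq_zero_iff_mem] at this
    exact this
  have hsum : ∀ k, a (n + k) = hbar ^ n • (c' + ∑ m ∈ Finset.range k, hbar ^ m • c (n + m)) := by
    intro k
    induction k with
    | zero => simpa using hc'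
    | succ k ih =>
      rw [Finset.sum_range_succ, ← add_assoc c', smul_add, ← ih, smul_smul, ← pow_add, ← hc]
      simp [add_assoc]
  refine ⟨of c' + series fun k => c (n + k), Subtype.ext (funext fun k => ?_)⟩
  rw [ha (n + k) k (by omega), hsum k]
  rfl

theorem exists_of_add (x : HC A) (n : ℕ) : ∃ a y, x = of a + hbar ^ n • y := by
  obtain ⟨a, ha⟩ := x.2 n
  have h : (x - of a).1 n = 0 := sub_eq_zero.2 (ha n le_rfl)
  obtain ⟨y, hy⟩ := exists_eq_smul h
  exact ⟨a, y, by rw [← hy]; abel⟩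

instance : HComplete (HC A) where
  eq_zero x hx := Subtype.ext (funext fun n => by
    obtain ⟨y, rfl⟩ := hx n
    exact hbar_pow_smul_quotient n _)
  exists_sum s := by
    have key : ∀ k n, k ≤ n → (∑ m ∈ Finset.range n, hbar ^ m • s m).1 k =
        (∑ m ∈ Finset.range k, hbar ^ m • s m).1 k := by
      intro k n hkn
      change eval k _ = eval k _
      rw [← Finset.sum_range_add_sum_Ico _ hkn, map_add, map_sum _ _ (Finset.Ico k n),
        Finset.sum_eq_zero (s := Finset.Ico k n), add_zero]
      intro m hm
      rw [map_smul, ← Nat.add_sub_cancel' (Finset.mem_Ico.1 hm).1, pow_add, mul_comm, mul_smul,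
        hbar_pow_smul_quotient, smul_zero]
    refine ⟨⟨fun n => (∑ m ∈ Finset.range n, hbar ^ m • s m).1 n, fun n => ?_⟩, fun n => ?_⟩
    · obtain ⟨a, ha⟩ := (∑ m ∈ Finset.range n, hbar ^ m • s m).2 n
      exact ⟨a, fun k hk => by rw [← ha k hk, key k n hk]⟩
    · obtain ⟨y, hy⟩ := exists_eq_smul (n := n)
        (z := ⟨fun n => (∑ m ∈ Finset.range n, hbar ^ m • s m).1 n, fun n => by
          obtain ⟨a, ha⟩ := (∑ m ∈ Finset.range n, hbar ^ m • s m).2 n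
          exact ⟨a, fun k hk => by rw [← ha k hk, key k n hk]⟩⟩ -
            ∑ m ∈ Finset.range n, hbar ^ m • s m) (sub_self _)
      exact ⟨y, by rw [← hy]; abel⟩

/-- Density: modulo each $\hbar^n$ an element of the completion comes from `A`, and the target is
separated. Multiplicativity, commutation and extensionality on completions are all reduced to this.
-/
theorem linearMap_ext {f g : HC A →ₗ[Kh] T} (h : ∀ a, f (of a) = g (of a)) : f = g := by
  ext x
  refine HComplete.eq_of_forall fun n => ?_
  obtain ⟨a, y, rfl⟩ := exists_of_add x n
  exact ⟨f y - g y, by simp only [map_add, map_smul, h, smul_sub]; abel⟩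

theorem algHom_ext {f g : HC A →ₐ[Kh] T} (h : ∀ a, f (of a) = g (of a)) : f = g :=
  AlgHom.toLinearMap_injective (linearMap_ext h)

theorem of_bijective : Function.Bijective (of : T → HC T) := by
  constructor
  · intro x y hxy
    refine HComplete.eq_of_forall fun n => ?_
    have := congrFun (congrArg Subtype.val hxy) n
    exact Ideal.Quotient.eq.1 this
  · intro x
    choose a ha using x.2
    have hc : ∀ k, ∃ c, a (k + 1) - a k = hbar ^ k • c := fun k => by
      have := ha (k + 1) k (by omega)
      rw [ha k k le_rfl, eq_comm, Ideal.Quotient.eq] at this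
      exact this
    choose c hc using hc
    obtain ⟨z, hz⟩ := HComplete.exists_sum c
    refine ⟨a 0 + z, Subtype.ext (funext fun n => ?_)⟩
    obtain ⟨y, hy⟩ := hz n
    rw [ha n n le_rfl]
    refine Ideal.Quotient.eq.2 ⟨y, ?_⟩
    have : a n = a 0 + ∑ m ∈ Finset.range n, hbar ^ m • c m := by
      simp_rw [← hc]
      rw [Finset.sum_range_sub]
      abel
    rw [hy, this]
    abel

variable (T) in
/-- A complete algebra is its own completion. -/
def ofEquiv : T ≃ₐ[Kh] HC T := AlgEquiv.ofBijective of of_bijective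

/-- Density is used once in each variable: first with the left factor in `A`, then with the right
factor arbitrary. -/
theorem lift_mul (f : A →ₐ[Kh] HC B) (x y : HC A) :
    lift f.toLinearMap (x * y) = lift f.toLinearMap x * lift f.toLinearMap y := by
  have h1 : ∀ a, lift f.toLinearMap ∘ₗ LinearMap.mulLeft Kh (of a) =
      LinearMap.mulLeft Kh (lift f.toLinearMap (of a)) ∘ₗ lift f.toLinearMap := fun a =>
    linearMap_ext fun b => by
      simp only [LinearMap.comp_apply, LinearMap.mulLeft_apply, ← map_mul of, lift_of]
      simp
  have h2 : lift f.toLinearMap ∘ₗ LinearMap.mulRight Kh y =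
      LinearMap.mulRight Kh (lift f.toLinearMap y) ∘ₗ lift f.toLinearMap :=
    linearMap_ext fun a => LinearMap.congr_fun (h1 a) y
  exact LinearMap.congr_fun h2 x

/-- The unique extension of an algebra homomorphism `A → B̂` to `Â → B̂`. -/
def liftAlg (f : A →ₐ[Kh] HC B) : HC A →ₐ[Kh] HC B :=
  AlgHom.ofLinearMap (lift f.toLinearMap) (by
    rw [← map_one of, lift_of]; simp) (lift_mul f)

/-- The unique extension to the completion of an algebra homomorphism to a complete algebra. -/
def extend (f : A →ₐ[Kh] T) : HC A →ₐ[Kh] T :=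
  (ofEquiv T).symm.toAlgHom.comp (liftAlg (of.comp f))

theorem extend_of (f : A →ₐ[Kh] T) (a : A) : extend f (of a) = f a :=
  (ofEquiv T).symm_apply_apply (f a)

/-- The completion of an algebra homomorphism. -/
def mapAlg (f : A →ₐ[Kh] B) : HC A →ₐ[Kh] HC B := liftAlg (of.comp f)

theorem mapAlg_of (f : A →ₐ[Kh] B) (a : A) : mapAlg f (of a) = of (f a) := rfl

theorem qpow_isHSum (x : A) : IsHSum (expTerm (of x)) (qpow x) := by
  have h : expTerm (of x) = fun n => of (PowerSeries.C (PowerSeries.coeff n qK) • x ^ n) :=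
    funext fun n => by simp [expTerm]
  rw [h]
  exact isHSum_series _

theorem qdiff_isHSum (x : A) : IsHSum (qdiffTerm (of x)) (qdiff x) := by
  have h : qdiffTerm (of x) = fun n =>
      of (PowerSeries.C (PowerSeries.coeff (n + 1) (qK - qKinv)) • x ^ (n + 1)) :=
    funext fun n => by simp [qdiffTerm]
  rw [h]
  exact isHSum_series _

theorem qpow_eq (x : A) : qpow x = hexp (of x) := (qpow_isHSum x).unique (isHSum_hexp _)

theorem commute_of_forall {f : HC A →ₗ[Kh] T} {g : HC B →ₗ[Kh] T}
    (h : ∀ a b, Commute (f (of a)) (g (of b))) (x : HC A) (y : HC B) : Commute (f x) (g y) := by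
  have h1 : ∀ a, LinearMap.mulLeft Kh (f (of a)) ∘ₗ g = LinearMap.mulRight Kh (f (of a)) ∘ₗ g :=
    fun a => linearMap_ext fun b => h a b
  have h2 : LinearMap.mulRight Kh (g y) ∘ₗ f = LinearMap.mulLeft Kh (g y) ∘ₗ f :=
    linearMap_ext fun a => LinearMap.congr_fun (h1 a) y
  exact LinearMap.congr_fun h2 x

/-- The completed inclusion of the left factor. -/
def inl : HC A →ₐ[Kh] Tensor A B :=
  mapAlg (Algebra.TensorProduct.includeLeft (R := Kh) (S := Kh) (A := A) (B := B))

/-- The completed inclusion of the right factor. -/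
def inr : HC B →ₐ[Kh] Tensor A B :=
  mapAlg (Algebra.TensorProduct.includeRight (R := Kh) (A := A) (B := B))

theorem inl_of (a : A) : (inl (of a) : Tensor A B) = of (a ⊗ₜ 1) := rfl

theorem inr_of (b : B) : (inr (of b) : Tensor A B) = of (1 ⊗ₜ b) := rfl

theorem commute_inl_inr (x : HC A) (y : HC B) : Commute (inl x : Tensor A B) (inr y) :=
  commute_of_forall (f := (inl : HC A →ₐ[Kh] Tensor A B).toLinearMap)
    (g := (inr : HC B →ₐ[Kh] Tensor A B).toLinearMap) (fun a b => by
      change Commute (inl (of a) : Tensor A B) (inr (of b))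
      rw [inl_of, inr_of, Commute, SemiconjBy, ← map_mul, ← map_mul]
      simp) x y

/-- The completed tensor product of two algebra homomorphisms. -/
def tensorAlg (f : A →ₐ[Kh] HC C) (g : B →ₐ[Kh] HC D) : Tensor A B →ₐ[Kh] Tensor C D :=
  liftAlg (Algebra.TensorProduct.lift (inl.comp f) (inr.comp g) fun _ _ => commute_inl_inr _ _)

theorem tensorAlg_of (f : A →ₐ[Kh] HC C) (g : B →ₐ[Kh] HC D) (a : A) (b : B) :
    tensorAlg f g (of (a ⊗ₜ b)) = inl (f a) * inr (g b) := rfl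

theorem linearMap_tensor_ext {f g : Tensor A B →ₗ[Kh] T}
    (h : ∀ a b, f (of (a ⊗ₜ b)) = g (of (a ⊗ₜ b))) : f = g := by
  refine linearMap_ext fun z => ?_
  have : f ∘ₗ of.toLinearMap = g ∘ₗ of.toLinearMap := TensorProduct.ext' h
  exact LinearMap.congr_fun this z

theorem tensorMap_eq (f : A →ₐ[Kh] HC C) (g : B →ₐ[Kh] HC D) :
    tensorMap f.toLinearMap g.toLinearMap = (tensorAlg f g).toLinearMap :=
  linearMap_tensor_ext fun _ _ => rfl

end HC

end Completeness

/-! ### The scalars $q^c$ and commutation of exponentials with weight vectors. -/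

section Exponentials

variable {T : Type*} [Ring T] [Algebra Kh T] [HComplete T]

/-- The scalar `q^c`. -/
def qs (c : ℂ) : Kh := hexp (PowerSeries.C c : Kh)

theorem qs_add (c d : ℂ) : qs (c + d) = qs c * qs d := by
  rw [qs, map_add, hexp_add (Commute.all _ _)]; rfl

theorem qs_zero : qs 0 = 1 := by rw [qs, map_zero, hexp_zero]

theorem qs_mul_qs_neg (c : ℂ) : qs c * qs (-c) = 1 := by
  rw [← qs_add, add_neg_cancel, qs_zero]

theorem isHSum_coeff (a : Kh) : IsHSum (fun n => PowerSeries.C (PowerSeries.coeff n a)) a := by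
  intro n
  have : (PowerSeries.X : Kh) ^ n ∣
      a - ∑ m ∈ Finset.range n, hbar ^ m • PowerSeries.C (PowerSeries.coeff m a) := by
    rw [PowerSeries.X_pow_dvd_iff]
    intro k hk
    rw [map_sub, map_sum, Finset.sum_eq_single k]
    · rw [smul_eq_mul, PowerSeries.coeff_X_pow_mul', if_pos le_rfl]
      simp
    · intro m _ hm
      rw [smul_eq_mul, PowerSeries.coeff_X_pow_mul']
      split_ifs with h
      · rw [PowerSeries.coeff_C, if_neg (by omega)]
      · rfl
    · intro h
      exact absurd (Finset.mem_range.2 hk) h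
  obtain ⟨y, hy⟩ := this
  exact ⟨y, by rw [smul_eq_mul, ← hy]; abel⟩

theorem qs_one : qs 1 = qK := by
  refine (isHSum_hexp _).unique ?_
  convert isHSum_coeff qK using 2 with n
  simp [expTerm]

theorem qs_neg_one : qs (-1) = qKinv := by
  refine (isHSum_hexp _).unique ?_
  convert isHSum_coeff qKinv using 2 with n
  rw [expTerm, coeff_qK, coeff_qKinv, ← map_pow, smul_eq_mul, ← map_mul, mul_comm]

theorem hexp_algebraMap (c : ℂ) :
    hexp (algebraMap Kh T (PowerSeries.C c)) = algebraMap Kh T (qs c) :=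
  (map_hexp (Algebra.ofId Kh T) (PowerSeries.C c)).symm

/-- The hypothesis says $e(x+c)=xe$, so $e$ intertwines the exponentials of $\hbar(x+c)$ and $\hbar
x$. -/
theorem hexp_mul_comm {x e : T} {c : ℂ} (h : x * e - e * x = PowerSeries.C c • e) :
    hexp x * e = qs c • (e * hexp x) := by
  have h1 : SemiconjBy e (x + algebraMap Kh T (PowerSeries.C c)) x := by
    rw [SemiconjBy, mul_add, ← Algebra.commutes, ← Algebra.smul_def, ← h]
    abel
  have h2 := h1.hexp_right.eq
  rw [hexp_add (Algebra.commutes _ _).symm, hexp_algebraMap, ← Algebra.commutes, ← Algebra.smul_def,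
    mul_smul_comm] at h2
  exact h2.symm

end Exponentials

theorem cartanMatrix_symm {N : ℕ} (i j : Fin N) : CartanMatrix.A N i j = CartanMatrix.A N j i := by
  simp only [CartanMatrix.A, Matrix.of_apply, eq_comm (a := i), or_comm]

/-! ### Completeness and universal property of $U_q(\mathfrak{sl}_{N+1})$; its Cartan part. -/

namespace Uq

variable {N : ℕ} {T : Type*} [Ring T] [Algebra Kh T] [HComplete T]

theorem mk_surjective : Function.Surjective (mk : HC (FreeGen N) →ₐ[Kh] Uq N) :=
  Ideal.Quotient.mk_surjective

theorem mk_eq_zero_iff {x : HC (FreeGen N)} : (mk x : Uq N) = 0 ↔ x ∈ relIdeal N := by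
  rw [← TwoSidedIdeal.mem_asIdeal]
  exact Ideal.Quotient.eq_zero_iff_mem

/-- Separatedness is the reason for dividing by the closure of the ideal of relations: an element
divisible by $\hbar^n$ lies in the ideal generated by the relations and $\hbar^n$, and `relIdeal` is
the intersection of these. -/
instance : HComplete (Uq N) := by
  refine HComplete.of_surjective mk mk_surjective HComplete.exists_sum fun x hx => ?_
  obtain ⟨z, rfl⟩ := mk_surjective x
  rw [mk_eq_zero_iff, relIdeal, TwoSidedIdeal.mem_iInf]
  intro n
  obtain ⟨y, hy⟩ := hx n
  obtain ⟨w, rfl⟩ := mk_surjective y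
  rw [← map_smul, ← sub_eq_zero, ← map_sub, mk_eq_zero_iff, relIdeal, TwoSidedIdeal.mem_iInf] at hy
  have h1 := hy n
  have h2 : hbar ^ n • w ∈ TwoSidedIdeal.span
      ({x | ∃ a b, UqRel N a b ∧ x = a - b} ∪ {algebraMap Kh (HC (FreeGen N)) (hbar ^ n)}) := by
    rw [Algebra.smul_def]
    exact TwoSidedIdeal.mul_mem_right _ _ _ (TwoSidedIdeal.subset_span (Or.inr rfl))
  simpa using TwoSidedIdeal.add_mem _ h1 h2

/-- The defining relations of `U_q(𝔰𝔩_{N+1})`, for elements of a complete algebra. -/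
structure Relations (h e f : Fin N → T) : Prop where
  hh : ∀ i j, h i * h j - h j * h i = 0
  he : ∀ i j, h i * e j - e j * h i = CartanMatrix.A N i j • e j
  hf : ∀ i j, h i * f j - f j * h i = -(CartanMatrix.A N i j • f j)
  ef_same : ∀ i, qdiffK • (e i * f i - f i * e i) = hqdiff (h i)
  ef_ne : ∀ i j, i ≠ j → e i * f j - f j * e i = 0
  serre_e : ∀ i j : Fin N, (i.val + 1 = j.val ∨ j.val + 1 = i.val) →
    e i ^ 2 * e j - (qK + qKinv) • (e i * e j * e i) + e j * e i ^ 2 = 0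
  serre_f : ∀ i j : Fin N, (i.val + 1 = j.val ∨ j.val + 1 = i.val) →
    f i ^ 2 * f j - (qK + qKinv) • (f i * f j * f i) + f j * f i ^ 2 = 0
  comm_e : ∀ i j : Fin N, ¬(i.val + 1 = j.val ∨ j.val + 1 = i.val) → e i * e j - e j * e i = 0
  comm_f : ∀ i j : Fin N, ¬(i.val + 1 = j.val ∨ j.val + 1 = i.val) → f i * f j - f j * f i = 0

theorem freeCartan_coroot (i : Fin N) : freeCartan (coroot i) = FreeAlgebra.ι Kh (Gen.h i) := by
  rw [freeCartan, Finset.sum_eq_single i]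
  · simp [coroot]
  · intro j _ hj
    simp [coroot, hj]
  · simp

/-- The homomorphism from the completed free algebra given by the values of the generators. -/
def freeLift (h e f : Fin N → T) : HC (FreeGen N) →ₐ[Kh] T :=
  HC.extend (FreeAlgebra.lift Kh fun g => match g with
    | Gen.h i => h i
    | Gen.e i => e i
    | Gen.f i => f i)

section freeLift

variable (h e f : Fin N → T) (i : Fin N)

theorem freeLift_h : freeLift h e f (genH (coroot i)) = h i := by
  rw [freeLift, genH, HC.extend_of, freeCartan_coroot, FreeAlgebra.lift_ι_apply]

theorem freeLift_e : freeLift h e f (genE i) = e i := by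
  rw [freeLift, genE, HC.extend_of, FreeAlgebra.lift_ι_apply]

theorem freeLift_f : freeLift h e f (genF i) = f i := by
  rw [freeLift, genF, HC.extend_of, FreeAlgebra.lift_ι_apply]

end freeLift

theorem free_hom_ext {φ ψ : HC (FreeGen N) →ₐ[Kh] T}
    (hh : ∀ i, φ (genH (coroot i)) = ψ (genH (coroot i))) (he : ∀ i, φ (genE i) = ψ (genE i))
    (hf : ∀ i, φ (genF i) = ψ (genF i)) : φ = ψ := by
  refine HC.algHom_ext fun a => ?_
  have : φ.comp HC.of = ψ.comp HC.of := by
    refine FreeAlgebra.hom_ext (funext fun g => ?_)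
    cases g with
    | h i => have := hh i; rw [genH, freeCartan_coroot] at this; exact this
    | e i => exact he i
    | f i => exact hf i
  exact AlgHom.congr_fun this a

theorem hom_ext {φ ψ : Uq N →ₐ[Kh] T}
    (hh : ∀ i, φ (H (coroot i)) = ψ (H (coroot i))) (he : ∀ i, φ (E i) = ψ (E i))
    (hf : ∀ i, φ (F i) = ψ (F i)) : φ = ψ := by
  have : φ.comp mk = ψ.comp mk := free_hom_ext hh he hf
  ext x
  obtain ⟨z, rfl⟩ := mk_surjective x
  exact AlgHom.congr_fun this z

theorem map_uqRel {φ : HC (FreeGen N) →ₐ[Kh] T}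
    (hφ : Relations (fun i => φ (genH (coroot i))) (fun i => φ (genE i)) (fun i => φ (genF i)))
    {a b : HC (FreeGen N)} (hab : UqRel N a b) : φ a = φ b := by
  cases hab with
  | hh i j => simpa using hφ.hh i j
  | he i j => simpa using hφ.he i j
  | hf i j => simpa using hφ.hf i j
  | ef_same i =>
    rw [map_eq_hqdiff φ (HC.qdiff_isHSum _)]
    simpa [genH] using hφ.ef_same i
  | ef_ne i j hij => simpa using hφ.ef_ne i j hij
  | serre_e i j hij => simpa using hφ.serre_e i j hij
  | serre_f i j hij => simpa using hφ.serre_f i j hij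
  | comm_e i j hij => simpa using hφ.comm_e i j hij
  | comm_f i j hij => simpa using hφ.comm_f i j hij

/-- Modulo $\hbar^n$ the map kills both the relations and $\hbar^n$, hence all of `relIdeal`; then
the target is separated. -/
theorem eq_zero_of_mem_relIdeal {φ : HC (FreeGen N) →ₐ[Kh] T}
    (hφ : Relations (fun i => φ (genH (coroot i))) (fun i => φ (genE i)) (fun i => φ (genF i)))
    {x : HC (FreeGen N)} (hx : x ∈ relIdeal N) : φ x = 0 := by
  refine HComplete.eq_zero _ fun n => ?_
  rw [relIdeal, TwoSidedIdeal.mem_iInf] at hx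
  let ψ : HC (FreeGen N) →+* T ⧸ hIdeal T n := (Ideal.Quotient.mk (hIdeal T n)).comp φ.toRingHom
  have hle : TwoSidedIdeal.span ({x | ∃ a b, UqRel N a b ∧ x = a - b} ∪
      {algebraMap Kh (HC (FreeGen N)) (hbar ^ n)}) ≤ TwoSidedIdeal.ker ψ := by
    rw [TwoSidedIdeal.span_le]
    rintro _ (⟨a, b, hab, rfl⟩ | rfl)
    · change _ ∈ TwoSidedIdeal.ker ψ
      rw [TwoSidedIdeal.mem_ker]
      change Ideal.Quotient.mk _ (φ (a - b)) = 0
      rw [map_sub, map_uqRel hφ hab, sub_self, map_zero]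
    · change _ ∈ TwoSidedIdeal.ker ψ
      rw [TwoSidedIdeal.mem_ker]
      change Ideal.Quotient.mk _ (φ (algebraMap Kh (HC (FreeGen N)) (hbar ^ n))) = 0
      rw [AlgHom.commutes, Algebra.algebraMap_eq_smul_one, HC.mk_hbar_pow_smul]
  have := hle (hx n)
  rw [TwoSidedIdeal.mem_ker] at this
  exact Ideal.Quotient.eq_zero_iff_mem.1 this

/-- The homomorphism from `U_q` to a complete algebra given by the values of the generators. -/
def lift {h e f : Fin N → T} (rel : Relations h e f) : Uq N →ₐ[Kh] T :=
  Ideal.Quotient.liftₐ (relIdeal N).asIdeal (freeLift h e f) fun x hx =>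
    eq_zero_of_mem_relIdeal (by simpa only [freeLift_h, freeLift_e, freeLift_f] using rel)
      (TwoSidedIdeal.mem_asIdeal.1 hx)

section lift

variable {h e f : Fin N → T} (rel : Relations h e f) (i : Fin N)

theorem lift_h : lift rel (H (coroot i)) = h i := freeLift_h h e f i

theorem lift_e : lift rel (E i) = e i := freeLift_e h e f i

theorem lift_f : lift rel (F i) = f i := freeLift_f h e f i

end lift

theorem mk_eq_of_uqRel {a b : HC (FreeGen N)} (hab : UqRel N a b) : (mk a : Uq N) = mk b := by
  rw [← sub_eq_zero, ← map_sub, mk_eq_zero_iff, relIdeal, TwoSidedIdeal.mem_iInf]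
  exact fun n => TwoSidedIdeal.subset_span (Or.inl ⟨a, b, hab, rfl⟩)

theorem relations : Relations (fun i : Fin N => H (coroot i)) E F where
  hh i j := by simpa [H, E, F] using mk_eq_of_uqRel (UqRel.hh i j)
  he i j := by simpa [H, E, F] using mk_eq_of_uqRel (UqRel.he i j)
  hf i j := by simpa [H, E, F] using mk_eq_of_uqRel (UqRel.hf i j)
  ef_same i := by
    have := mk_eq_of_uqRel (UqRel.ef_same i)
    rw [map_eq_hqdiff mk (HC.qdiff_isHSum _)] at this
    simpa [H, E, F, genH] using this
  ef_ne i j hij := by simpa [H, E, F] using mk_eq_of_uqRel (UqRel.ef_ne i j hij)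
  serre_e i j hij := by simpa [H, E, F] using mk_eq_of_uqRel (UqRel.serre_e i j hij)
  serre_f i j hij := by simpa [H, E, F] using mk_eq_of_uqRel (UqRel.serre_f i j hij)
  comm_e i j hij := by simpa [H, E, F] using mk_eq_of_uqRel (UqRel.comm_e i j hij)
  comm_f i j hij := by simpa [H, E, F] using mk_eq_of_uqRel (UqRel.comm_f i j hij)

theorem H_eq (x : Cartan N) : H x = ∑ i, PowerSeries.C (x i) • H (coroot i) := by
  simp only [H, genH, freeCartan_coroot]
  simp [freeCartan]

theorem H_add (x y : Cartan N) : H (x + y) = H x + H y := by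
  rw [H_eq, H_eq x, H_eq y, ← Finset.sum_add_distrib]
  simp [add_smul]

theorem H_neg (x : Cartan N) : H (-x) = -H x := by
  rw [H_eq, H_eq x, ← Finset.sum_neg_distrib]
  simp

theorem H_zero : (H 0 : Uq N) = 0 := by
  rw [H_eq]
  simp

theorem qH_eq (x : Cartan N) : qH x = hexp (H x) := map_eq_hexp mk (HC.qpow_isHSum _)

theorem commute_H (x y : Cartan N) : Commute (H x) (H y) := by
  rw [H_eq x, H_eq y]
  refine Commute.sum_left _ _ _ fun i _ => Commute.sum_right _ _ _ fun j _ => ?_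
  exact (Commute.smul_right (sub_eq_zero.1 (relations.hh i j)) _).smul_left _

theorem commute_qH_H (x y : Cartan N) : Commute (qH x) (H y) := by
  rw [qH_eq]; exact (commute_H x y).hexp_left

theorem commute_qH (x y : Cartan N) : Commute (qH x) (qH y) := by
  rw [qH_eq y]; exact (commute_qH_H x y).hexp_right

theorem qH_add (x y : Cartan N) : qH (x + y) = qH x * qH y := by
  rw [qH_eq, H_add, hexp_add (commute_H x y), qH_eq, qH_eq]

theorem qH_zero : (qH 0 : Uq N) = 1 := by rw [qH_eq, H_zero, hexp_zero]

theorem qH_mul_qH_neg (x : Cartan N) : qH x * qH (-x) = 1 := by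
  rw [← qH_add, add_neg_cancel, qH_zero]

theorem qH_neg_mul_qH (x : Cartan N) : qH (-x) * qH x = 1 := by
  rw [← qH_add, neg_add_cancel, qH_zero]

theorem simpleRoot_apply (j : Fin N) (x : Cartan N) :
    simpleRoot j x = ∑ i, (CartanMatrix.A N i j : ℂ) * x i := by
  simp [simpleRoot, cartanMatrix_symm j]

theorem simpleRoot_coroot (i j : Fin N) :
    simpleRoot i (coroot j) = (CartanMatrix.A N i j : ℂ) := by
  simp [simpleRoot_apply, coroot, Pi.single_apply, cartanMatrix_symm j i]

theorem C_intCast_smul {M : Type*} [AddCommGroup M] [Module Kh M] (n : ℤ) (x : M) : PowerSeries.C (n : ℂ) • x = n • x := by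
  rw [map_intCast, Int.cast_smul_eq_zsmul]

theorem H_mul_E (x : Cartan N) (j : Fin N) :
    H x * E j - E j * H x = PowerSeries.C (simpleRoot j x) • E j := by
  rw [H_eq, Finset.sum_mul, Finset.mul_sum, ← Finset.sum_sub_distrib, simpleRoot_apply, map_sum,
    Finset.sum_smul]
  refine Finset.sum_congr rfl fun i _ => ?_
  rw [smul_mul_assoc, mul_smul_comm, ← smul_sub, relations.he, mul_comm, map_mul, mul_smul,
    C_intCast_smul]

theorem H_mul_F (x : Cartan N) (j : Fin N) :
    H x * F j - F j * H x = PowerSeries.C (-simpleRoot j x) • F j := by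
  rw [H_eq, Finset.sum_mul, Finset.mul_sum, ← Finset.sum_sub_distrib, simpleRoot_apply, map_neg,
    neg_smul, map_sum, Finset.sum_smul, ← Finset.sum_neg_distrib]
  refine Finset.sum_congr rfl fun i _ => ?_
  rw [smul_mul_assoc, mul_smul_comm, ← smul_sub, relations.hf, mul_comm, map_mul, mul_smul,
    C_intCast_smul, smul_neg]

theorem qH_mul_E (x : Cartan N) (j : Fin N) :
    qH x * E j = qs (simpleRoot j x) • (E j * qH x) := by
  rw [qH_eq]; exact hexp_mul_comm (H_mul_E x j)

theorem qH_mul_F (x : Cartan N) (j : Fin N) :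
    qH x * F j = qs (-simpleRoot j x) • (F j * qH x) := by
  rw [qH_eq]; exact hexp_mul_comm (H_mul_F x j)

end Uq

/-! ### The convolutions $x\otimes y\mapsto S(x)y$ and $x\otimes y\mapsto xS(y)$. -/

section Convolution

open HC

variable {A : Type*} [Ring A] [Algebra Kh A]
variable {B : Type*} [Ring B] [Algebra Kh B]
variable {C : Type*} [Ring C] [Algebra Kh C]
variable {D : Type*} [Ring D] [Algebra Kh D]

theorem HC.tensorAlg_of_eq {f : A →ₐ[Kh] HC C} {g : B →ₐ[Kh] HC D} {a : A} {b : B} {c : C} {d : D}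
    (ha : f a = of c) (hb : g b = of d) : tensorAlg f g (of (a ⊗ₜ b)) = of (c ⊗ₜ d) := by
  rw [tensorAlg_of, ha, hb, inl_of, inr_of, ← map_mul]
  simp

theorem HC.of_tmul_one_hexp [HComplete A] (x : A) :
    (of (hexp x ⊗ₜ 1) : Tensor A B) = hexp (of (x ⊗ₜ 1)) := by
  have := map_hexp ((of : A ⊗[Kh] B →ₐ[Kh] _).comp
    (Algebra.TensorProduct.includeLeft : A →ₐ[Kh] A ⊗[Kh] B)) x
  simpa only [AlgHom.comp_apply, Algebra.TensorProduct.includeLeft_apply] using this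

theorem HC.of_one_tmul_hexp [HComplete B] (x : B) :
    (of (1 ⊗ₜ hexp x) : Tensor A B) = hexp (of (1 ⊗ₜ x)) := by
  have := map_hexp ((of : A ⊗[Kh] B →ₐ[Kh] _).comp
    (Algebra.TensorProduct.includeRight : B →ₐ[Kh] A ⊗[Kh] B)) x
  simpa only [AlgHom.comp_apply, Algebra.TensorProduct.includeRight_apply] using this

/-- The linear map underlying an algebra anti-homomorphism. -/
def unopLinear (S : A →ₐ[Kh] Aᵐᵒᵖ) : A →ₗ[Kh] A :=
  (MulOpposite.opLinearEquiv Kh).symm.toLinearMap ∘ₗ S.toLinearMap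

theorem unopLinear_apply (S : A →ₐ[Kh] Aᵐᵒᵖ) (a : A) : unopLinear S a = (S a).unop := rfl

theorem unopLinear_mul (S : A →ₐ[Kh] Aᵐᵒᵖ) (a b : A) :
    unopLinear S (a * b) = unopLinear S b * unopLinear S a := by
  simp [unopLinear_apply]

/-- The map `x ⊗ y ↦ S(x) y`. -/
def convLeft (S : A →ₗ[Kh] A) : Tensor A A →ₗ[Kh] HC A :=
  HC.mul ∘ₗ tensorMap (of.toLinearMap ∘ₗ S) of.toLinearMap

/-- The map `x ⊗ y ↦ x S(y)`. -/
def convRight (S : A →ₗ[Kh] A) : Tensor A A →ₗ[Kh] HC A :=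
  HC.mul ∘ₗ tensorMap of.toLinearMap (of.toLinearMap ∘ₗ S)

theorem HC.mul_inl_inr (x y : A) : HC.mul (inl (of x) * inr (of y)) = of (x * y) := by
  rw [inl_of, inr_of, ← map_mul, Algebra.TensorProduct.tmul_mul_tmul, one_mul, mul_one]
  rfl

theorem convLeft_of (S : A →ₗ[Kh] A) (x y : A) : convLeft S (of (x ⊗ₜ y)) = of (S x * y) :=
  HC.mul_inl_inr _ _

theorem convRight_of (S : A →ₗ[Kh] A) (x y : A) : convRight S (of (x ⊗ₜ y)) = of (x * S y) :=
  HC.mul_inl_inr _ _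

/-- For $w=\sum w'\otimes w''$ and $z=a\otimes b$ the left side is $S(a)\bigl(\sum S(w')w''\bigr)b$,
and the middle factor is a scalar. With $w=\Delta(x)$ and $z=\Delta(y)$ this makes the antipode
axiom multiplicative, so it can be checked on generators. -/
theorem convLeft_mul (S : A →ₐ[Kh] Aᵐᵒᵖ) {w : Tensor A A} {c : Kh}
    (hw : convLeft (unopLinear S) w = algebraMap Kh (HC A) c) (z : Tensor A A) :
    convLeft (unopLinear S) (w * z) = c • convLeft (unopLinear S) z := by
  have h : ∀ a b, convLeft (unopLinear S) ∘ₗ LinearMap.mulRight Kh (of (a ⊗ₜ b)) =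
      LinearMap.mulLeft Kh (of (unopLinear S a)) ∘ₗ LinearMap.mulRight Kh (of b) ∘ₗ
        convLeft (unopLinear S) := fun a b => linearMap_tensor_ext fun x y => by
    simp only [LinearMap.comp_apply, LinearMap.mulLeft_apply, LinearMap.mulRight_apply,
      ← map_mul of, Algebra.TensorProduct.tmul_mul_tmul, convLeft_of, unopLinear_mul, mul_assoc]
  have : convLeft (unopLinear S) ∘ₗ LinearMap.mulLeft Kh w = c • convLeft (unopLinear S) :=
    linearMap_tensor_ext fun a b => by
      have := LinearMap.congr_fun (h a b) w
      simp only [LinearMap.comp_apply, LinearMap.mulLeft_apply, LinearMap.mulRight_apply, hw] at this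
      rw [LinearMap.comp_apply, LinearMap.mulLeft_apply, this, LinearMap.smul_apply, convLeft_of,
        map_mul, Algebra.smul_def, Algebra.left_comm]
  exact LinearMap.congr_fun this z

theorem convRight_mul (S : A →ₐ[Kh] Aᵐᵒᵖ) {w : Tensor A A} {c : Kh}
    (hw : convRight (unopLinear S) w = algebraMap Kh (HC A) c) (z : Tensor A A) :
    convRight (unopLinear S) (z * w) = c • convRight (unopLinear S) z := by
  have h : ∀ a b, convRight (unopLinear S) ∘ₗ LinearMap.mulLeft Kh (of (a ⊗ₜ b)) =
      LinearMap.mulLeft Kh (of a) ∘ₗ LinearMap.mulRight Kh (of (unopLinear S b)) ∘ₗ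
        convRight (unopLinear S) := fun a b => linearMap_tensor_ext fun x y => by
    simp only [LinearMap.comp_apply, LinearMap.mulLeft_apply, LinearMap.mulRight_apply,
      ← map_mul of, Algebra.TensorProduct.tmul_mul_tmul, convRight_of, unopLinear_mul, mul_assoc]
  have : convRight (unopLinear S) ∘ₗ LinearMap.mulRight Kh w = c • convRight (unopLinear S) :=
    linearMap_tensor_ext fun a b => by
      have := LinearMap.congr_fun (h a b) w
      simp only [LinearMap.comp_apply, LinearMap.mulLeft_apply, LinearMap.mulRight_apply, hw] at this
      rw [LinearMap.comp_apply, LinearMap.mulRight_apply, this, LinearMap.smul_apply, convRight_of,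
        map_mul, Algebra.smul_def, Algebra.left_comm]
  exact LinearMap.congr_fun this z

end Convolution

/-! ### Hopf structures from skew primitive generators. -/

namespace Uq

open HC

variable {N : ℕ}

/-- Serves the antipode axioms: neither $x\mapsto\sum S(x')x''$ nor its mirror image is an algebra
homomorphism a priori, so `hom_ext` does not apply and closure under products enters as a
hypothesis. -/
theorem linearMap_ext_of_mul {T : Type*} [Ring T] [Algebra Kh T] [HComplete T]
    {φ ψ : Uq N →ₗ[Kh] T} (h1 : φ 1 = ψ 1) (hh : ∀ i, φ (H (coroot i)) = ψ (H (coroot i)))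
    (he : ∀ i, φ (E i) = ψ (E i)) (hf : ∀ i, φ (F i) = ψ (F i))
    (hmul : ∀ x y, φ x = ψ x → φ y = ψ y → φ (x * y) = ψ (x * y)) : φ = ψ := by
  have : φ ∘ₗ mk.toLinearMap = ψ ∘ₗ mk.toLinearMap := linearMap_ext fun a => by
    change φ (mk (of a)) = ψ (mk (of a))
    induction a using FreeAlgebra.induction with
    | grade0 r => rw [AlgHom.commutes, AlgHom.commutes, Algebra.algebraMap_eq_smul_one, map_smul,
        map_smul, h1]
    | grade1 g =>
      cases g with
      | h i => have := hh i; rw [H, genH, freeCartan_coroot] at this; exact this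
      | e i => exact he i
      | f i => exact hf i
    | mul a b ha hb => rw [map_mul, map_mul]; exact hmul _ _ ha hb
    | add a b ha hb => rw [map_add, map_add, map_add, map_add, ha, hb]
  ext x
  obtain ⟨z, rfl⟩ := mk_surjective x
  exact LinearMap.congr_fun this z

/-- A coproduct for which the `h_{α_i}` are primitive and the `e_{±α_i}` are skew primitive. -/
structure IsSkewPrimitive (Δ : Uq N →ₐ[Kh] Tensor (Uq N) (Uq N)) (a b c d : Fin N → Cartan N) :
    Prop where
  h : ∀ i, Δ (H (coroot i)) = of (H (coroot i) ⊗ₜ 1 + 1 ⊗ₜ H (coroot i))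
  e : ∀ i, Δ (E i) = of (qH (a i) ⊗ₜ E i + E i ⊗ₜ qH (b i))
  f : ∀ i, Δ (F i) = of (F i ⊗ₜ qH (c i) + qH (d i) ⊗ₜ F i)

theorem of_H_tmul_add (x : Cartan N) :
    (of (H x ⊗ₜ 1 + 1 ⊗ₜ H x) : Tensor (Uq N) (Uq N)) =
      ∑ i, PowerSeries.C (x i) • of (H (coroot i) ⊗ₜ 1 + 1 ⊗ₜ H (coroot i)) := by
  rw [H_eq]
  simp only [TensorProduct.sum_tmul, TensorProduct.tmul_sum, TensorProduct.tmul_smul,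
    TensorProduct.smul_tmul', ← map_smul, ← map_sum, smul_add, Finset.sum_add_distrib]

theorem hexp_of_H_tmul_add (x y : Cartan N) :
    hexp (of (H x ⊗ₜ 1 + 1 ⊗ₜ H y) : Tensor (Uq N) (Uq N)) = of (qH x ⊗ₜ qH y) := by
  have : Commute (of (H x ⊗ₜ 1) : Tensor (Uq N) (Uq N)) (of (1 ⊗ₜ H y)) := by
    rw [Commute, SemiconjBy, ← map_mul, ← map_mul]
    simp
  rw [map_add, hexp_add this, ← of_tmul_one_hexp, ← of_one_tmul_hexp, ← map_mul, qH_eq, qH_eq]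
  simp

namespace IsSkewPrimitive

variable {Δ : Uq N →ₐ[Kh] Tensor (Uq N) (Uq N)} {a b c d : Fin N → Cartan N}

theorem comul_H (hΔ : IsSkewPrimitive Δ a b c d) (x : Cartan N) :
    Δ (H x) = of (H x ⊗ₜ 1 + 1 ⊗ₜ H x) := by
  rw [of_H_tmul_add, H_eq, map_sum]
  simp only [map_smul, hΔ.h]

theorem comul_qH (hΔ : IsSkewPrimitive Δ a b c d) (x : Cartan N) :
    Δ (qH x) = of (qH x ⊗ₜ qH x) := by
  rw [← hexp_of_H_tmul_add, ← hΔ.comul_H, qH_eq, map_hexp]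

/-- Both sides are algebra homomorphisms, so the generators suffice; there it amounts to the
elements $q^x$ being group-like. -/
theorem coassoc (hΔ : IsSkewPrimitive Δ a b c d) :
    (mapAlg (Algebra.TensorProduct.assoc Kh Kh Kh (Uq N) (Uq N) (Uq N)).toAlgHom).comp
      ((tensorAlg Δ of).comp Δ) = (tensorAlg of Δ).comp Δ := by
  have h1 : Δ 1 = of (1 ⊗ₜ 1) := by rw [map_one]; exact (map_one of).symm
  refine hom_ext (fun i => ?_) (fun i => ?_) (fun i => ?_)
  · simp only [AlgHom.comp_apply, hΔ.h, map_add,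
      tensorAlg_of_eq (hΔ.h i) (rfl : of (1 : Uq N) = of 1), tensorAlg_of_eq h1 (rfl : of _ = of _),
      tensorAlg_of_eq (rfl : of _ = of _) h1, tensorAlg_of_eq (rfl : of (1 : Uq N) = of 1) (hΔ.h i),
      mapAlg_of, TensorProduct.add_tmul, TensorProduct.tmul_add]
    simp [add_assoc]
  · simp only [AlgHom.comp_apply, hΔ.e, map_add,
      tensorAlg_of_eq (hΔ.comul_qH _) (rfl : of (E i : Uq N) = of _),
      tensorAlg_of_eq (hΔ.e i) (rfl : of _ = of _),
      tensorAlg_of_eq (rfl : of _ = of _) (hΔ.e i),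
      tensorAlg_of_eq (rfl : of (E i : Uq N) = of _) (hΔ.comul_qH _),
      mapAlg_of, TensorProduct.add_tmul, TensorProduct.tmul_add]
    simp [add_assoc]
  · simp only [AlgHom.comp_apply, hΔ.f, map_add,
      tensorAlg_of_eq (hΔ.comul_qH _) (rfl : of (F i : Uq N) = of _),
      tensorAlg_of_eq (hΔ.f i) (rfl : of _ = of _),
      tensorAlg_of_eq (rfl : of _ = of _) (hΔ.f i),
      tensorAlg_of_eq (rfl : of (F i : Uq N) = of _) (hΔ.comul_qH _),
      mapAlg_of, TensorProduct.add_tmul, TensorProduct.tmul_add]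
    simp [add_assoc]

variable {ε : Uq N →ₐ[Kh] Kh}

theorem counit_H (hh : ∀ i, ε (H (coroot i)) = 0) (x : Cartan N) : ε (H x) = 0 := by
  rw [H_eq, map_sum]
  simp [hh]

theorem counit_qH (hh : ∀ i, ε (H (coroot i)) = 0) (x : Cartan N) : ε (qH x) = 1 := by
  rw [qH_eq, map_hexp, counit_H hh, hexp_zero]

theorem counit_left (hΔ : IsSkewPrimitive Δ a b c d) (hh : ∀ i, ε (H (coroot i)) = 0)
    (he : ∀ i, ε (E i) = 0) (hf : ∀ i, ε (F i) = 0) :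
    (mapAlg (Algebra.TensorProduct.lid Kh (Uq N)).toAlgHom).comp
      ((tensorAlg (of.comp ε) of).comp Δ) = of := by
  have key : ∀ x y : Uq N, mapAlg (Algebra.TensorProduct.lid Kh (Uq N)).toAlgHom
      (tensorAlg (of.comp ε) of (of (x ⊗ₜ y))) = of (ε x • y) := fun x y => by
    rw [tensorAlg_of_eq (f := of.comp ε) (c := ε x) (d := y) rfl rfl, mapAlg_of]
    simp
  refine hom_ext (fun i => ?_) (fun i => ?_) (fun i => ?_)
  · simp only [AlgHom.comp_apply, hΔ.h, map_add, key, hh, map_one]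
    simp
  · simp only [AlgHom.comp_apply, hΔ.e, map_add, key, he, counit_qH hh]
    simp
  · simp only [AlgHom.comp_apply, hΔ.f, map_add, key, hf, counit_qH hh]
    simp

theorem counit_right (hΔ : IsSkewPrimitive Δ a b c d) (hh : ∀ i, ε (H (coroot i)) = 0)
    (he : ∀ i, ε (E i) = 0) (hf : ∀ i, ε (F i) = 0) :
    (mapAlg (Algebra.TensorProduct.rid Kh Kh (Uq N)).toAlgHom).comp
      ((tensorAlg of (of.comp ε)).comp Δ) = of := by
  have key : ∀ x y : Uq N, mapAlg (Algebra.TensorProduct.rid Kh Kh (Uq N)).toAlgHom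
      (tensorAlg of (of.comp ε) (of (x ⊗ₜ y))) = of (ε y • x) := fun x y => by
    rw [tensorAlg_of_eq (g := of.comp ε) (c := x) (d := ε y) rfl rfl, mapAlg_of]
    simp
  refine hom_ext (fun i => ?_) (fun i => ?_) (fun i => ?_)
  · simp only [AlgHom.comp_apply, hΔ.h, map_add, key, hh, map_one]
    simp
  · simp only [AlgHom.comp_apply, hΔ.e, map_add, key, he, counit_qH hh]
    simp
  · simp only [AlgHom.comp_apply, hΔ.f, map_add, key, hf, counit_qH hh]
    simp

end IsSkewPrimitive

/-- The antipode of a coproduct for which the `e_{±α_i}` are skew primitive, as an algebra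
anti-homomorphism. -/
structure IsSkewAntipode (S : Uq N →ₐ[Kh] (Uq N)ᵐᵒᵖ) (a b c d : Fin N → Cartan N) : Prop where
  h : ∀ i, S (H (coroot i)) = MulOpposite.op (-H (coroot i))
  e : ∀ i, S (E i) = MulOpposite.op (-(qH (-a i) * E i * qH (-b i)))
  f : ∀ i, S (F i) = MulOpposite.op (-(qH (-d i) * F i * qH (-c i)))

namespace IsSkewAntipode

variable {S : Uq N →ₐ[Kh] (Uq N)ᵐᵒᵖ} {a b c d : Fin N → Cartan N}

theorem antipode_H (hS : IsSkewAntipode S a b c d) (x : Cartan N) :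
    S (H x) = MulOpposite.op (H (-x)) := by
  rw [H_eq, map_sum, H_eq]
  simp [hS.h]

theorem antipode_qH (hS : IsSkewAntipode S a b c d) (x : Cartan N) :
    unopLinear S (qH x) = qH (-x) := by
  rw [unopLinear_apply, qH_eq, map_hexp, hS.antipode_H, ← op_hexp, ← qH_eq, MulOpposite.unop_op]

end IsSkewAntipode

section ofSkewPrimitive

variable {Δ : Uq N →ₐ[Kh] Tensor (Uq N) (Uq N)} {a b c d : Fin N → Cartan N}
  {ε : Uq N →ₐ[Kh] Kh} {S : Uq N →ₐ[Kh] (Uq N)ᵐᵒᵖ}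

/-- On $e_{\alpha_i}$ the sum is $q^{-a}e-(q^{-a}eq^{-b})q^b=0$, which is what dictates the formula
in `IsSkewAntipode`; $e_{-\alpha_i}$ is alike, and products are handled by `convLeft_mul`. -/
theorem antipode_left_of_skew (hΔ : IsSkewPrimitive Δ a b c d) (hh : ∀ i, ε (H (coroot i)) = 0)
    (he : ∀ i, ε (E i) = 0) (hf : ∀ i, ε (F i) = 0) (hS : IsSkewAntipode S a b c d) :
    convLeft (unopLinear S) ∘ₗ Δ.toLinearMap =
      (Algebra.linearMap Kh (HC (Uq N))) ∘ₗ ε.toLinearMap := by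
  have h1 : unopLinear S 1 = 1 := by simp [unopLinear_apply]
  refine linearMap_ext_of_mul ?_ (fun i => ?_) (fun i => ?_) (fun i => ?_) fun x y hx hy => ?_
  · simp only [LinearMap.comp_apply, AlgHom.toLinearMap_apply, map_one]
    exact (convLeft_of (unopLinear S) 1 1).trans (by rw [h1]; simp)
  · simp only [LinearMap.comp_apply, AlgHom.toLinearMap_apply, hΔ.h, map_add, convLeft_of, h1, hh]
    rw [unopLinear_apply, hS.h]
    simp
  · simp only [LinearMap.comp_apply, AlgHom.toLinearMap_apply, hΔ.e, map_add, convLeft_of, he,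
      hS.antipode_qH]
    rw [unopLinear_apply, hS.e, MulOpposite.unop_op, neg_mul, mul_assoc _ _ (qH (b i)),
      qH_neg_mul_qH]
    simp
  · simp only [LinearMap.comp_apply, AlgHom.toLinearMap_apply, hΔ.f, map_add, convLeft_of, hf,
      hS.antipode_qH]
    rw [unopLinear_apply, hS.f, MulOpposite.unop_op, neg_mul, mul_assoc _ _ (qH (c i)),
      qH_neg_mul_qH]
    simp
  · simp only [LinearMap.comp_apply, AlgHom.toLinearMap_apply] at hx hy ⊢
    rw [map_mul, convLeft_mul S hx, hy, map_mul, ← smul_eq_mul, map_smul]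

theorem antipode_right_of_skew (hΔ : IsSkewPrimitive Δ a b c d) (hh : ∀ i, ε (H (coroot i)) = 0)
    (he : ∀ i, ε (E i) = 0) (hf : ∀ i, ε (F i) = 0) (hS : IsSkewAntipode S a b c d) :
    convRight (unopLinear S) ∘ₗ Δ.toLinearMap =
      (Algebra.linearMap Kh (HC (Uq N))) ∘ₗ ε.toLinearMap := by
  have h1 : unopLinear S 1 = 1 := by simp [unopLinear_apply]
  refine linearMap_ext_of_mul ?_ (fun i => ?_) (fun i => ?_) (fun i => ?_) fun x y hx hy => ?_
  · simp only [LinearMap.comp_apply, AlgHom.toLinearMap_apply, map_one]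
    exact (convRight_of (unopLinear S) 1 1).trans (by rw [h1]; simp)
  · simp only [LinearMap.comp_apply, AlgHom.toLinearMap_apply, hΔ.h, map_add, convRight_of, h1, hh]
    rw [unopLinear_apply, hS.h]
    simp
  · simp only [LinearMap.comp_apply, AlgHom.toLinearMap_apply, hΔ.e, map_add, convRight_of, he,
      hS.antipode_qH]
    rw [unopLinear_apply, hS.e, MulOpposite.unop_op, mul_neg, ← mul_assoc, ← mul_assoc,
      qH_mul_qH_neg]
    simp
  · simp only [LinearMap.comp_apply, AlgHom.toLinearMap_apply, hΔ.f, map_add, convRight_of, hf,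
      hS.antipode_qH]
    rw [unopLinear_apply, hS.f, MulOpposite.unop_op, mul_neg, ← mul_assoc, ← mul_assoc,
      qH_mul_qH_neg]
    simp
  · simp only [LinearMap.comp_apply, AlgHom.toLinearMap_apply] at hx hy ⊢
    rw [map_mul, convRight_mul S hy, hx, map_mul, mul_comm, ← smul_eq_mul, map_smul]

/-- The topological Hopf algebra given by a coproduct for which the `h_{α_i}` are primitive and the
`e_{±α_i}` are skew primitive. -/
def hopfOfSkewPrimitive (hΔ : IsSkewPrimitive Δ a b c d) (hh : ∀ i, ε (H (coroot i)) = 0)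
    (he : ∀ i, ε (E i) = 0) (hf : ∀ i, ε (F i) = 0) (hS : IsSkewAntipode S a b c d) :
    TopHopf (Uq N) where
  comul := Δ
  counit := ε
  antipode := unopLinear S
  coassoc x := by
    have := AlgHom.congr_fun hΔ.coassoc x
    rw [tensorMap_eq, tensorMap_eq]
    exact this
  counit_left x := by
    have := AlgHom.congr_fun (hΔ.counit_left hh he hf) x
    rw [← AlgHom.comp_toLinearMap, tensorMap_eq]
    exact this
  counit_right x := by
    have := AlgHom.congr_fun (hΔ.counit_right hh he hf) x
    rw [← AlgHom.comp_toLinearMap, tensorMap_eq]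
    exact this
  antipode_left x := LinearMap.congr_fun (antipode_left_of_skew hΔ hh he hf hS) x
  antipode_right x := LinearMap.congr_fun (antipode_right_of_skew hΔ hh he hf hS) x

end ofSkewPrimitive

end Uq

/-! ### Quantum Serre relations for products and sums of skew-commuting elements. -/

section SerreAlgebra

variable {R T : Type*} [CommRing R] [Ring T] [Algebra R T]

/-- Each of the three monomials contains $ke$ twice and $lf$ once, and moving $k,k,l$ to the left
costs $\alpha\beta^2$ in every order because $e$ past $l$ and $f$ past $k$ cost the same $\beta$.
The Serre expression therefore only acquires a common factor. -/
theorem serre_smul_mul {k l e f : T} {α β : R} (c s t : R) (hkl : l * k = k * l)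
    (hek : e * k = α • (k * e)) (hel : e * l = β • (l * e)) (hfk : f * k = β • (k * f)) :
    (s • (k * e)) ^ 2 * (t • (l * f)) - c • ((s • (k * e)) * (t • (l * f)) * (s • (k * e))) +
        (t • (l * f)) * (s • (k * e)) ^ 2 =
      (s * s * t * (α * β * β)) • (k * k * l * (e ^ 2 * f - c • (e * f * e) + f * e ^ 2)) := by
  have h1 : k * e * (k * e) * (l * f) = (α * β * β) • (k * k * l * (e * e * f)) := by
    calc k * e * (k * e) * (l * f) = k * (e * k) * (e * l) * f := by noncomm_ring
      _ = (α * β) • (k * k * (e * l) * e * f) := by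
        rw [hek, hel]
        simp only [mul_smul_comm, smul_mul_assoc, smul_smul, ← mul_assoc]
        rw [mul_assoc (k * k) e l, hel]
        simp only [mul_smul_comm, smul_mul_assoc, smul_smul, ← mul_assoc]
        rw [mul_comm β α]
      _ = _ := by
        rw [hel]
        simp only [mul_smul_comm, smul_mul_assoc, smul_smul, mul_assoc]
  have h2 : k * e * (l * f) * (k * e) = (α * β * β) • (k * k * l * (e * f * e)) := by
    calc k * e * (l * f) * (k * e) = k * (e * l) * (f * k) * e := by noncomm_ring
      _ = (β * β) • (k * l * (e * k) * f * e) := by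
        rw [hel, hfk]
        simp only [mul_smul_comm, smul_mul_assoc, smul_smul, ← mul_assoc]
      _ = (α * β * β) • (k * (l * k) * e * f * e) := by
        rw [hek]
        simp only [mul_smul_comm, smul_mul_assoc, smul_smul, ← mul_assoc]
        congr 1
        ring
      _ = _ := by
        rw [hkl]
        simp only [mul_assoc]
  have h3 : l * f * (k * e) * (k * e) = (α * β * β) • (k * k * l * (f * e * e)) := by
    calc l * f * (k * e) * (k * e) = l * (f * k) * (e * k) * e := by noncomm_ring
      _ = (β * α) • (l * k * (f * k) * e * e) := by
        rw [hek, hfk]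
        simp only [mul_smul_comm, smul_mul_assoc, smul_smul, ← mul_assoc]
        rw [mul_assoc (l * k) f k, hfk]
        simp only [mul_smul_comm, smul_mul_assoc, smul_smul, ← mul_assoc, mul_comm α β]
      _ = (α * β * β) • (l * k * k * f * e * e) := by
        rw [hfk]
        simp only [mul_smul_comm, smul_mul_assoc, smul_smul, ← mul_assoc, mul_comm β α]
      _ = _ := by
        rw [hkl, mul_assoc k l k, hkl]
        simp only [mul_assoc]
  have h4 : (s • (k * e)) ^ 2 * (t • (l * f)) -
      c • ((s • (k * e)) * (t • (l * f)) * (s • (k * e))) + (t • (l * f)) * (s • (k * e)) ^ 2 =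
      (s * s * t) • (k * e * (k * e) * (l * f)) - (c * (s * s * t)) • (k * e * (l * f) * (k * e)) +
        (s * s * t) • (l * f * (k * e) * (k * e)) := by
    simp only [pow_two, smul_mul_assoc, mul_smul_comm, smul_smul, mul_assoc, mul_comm t]
  rw [h4, h1, h2, h3, pow_two, ← mul_assoc f]
  simp only [mul_add, mul_sub, mul_smul_comm, smul_add, smul_sub, smul_smul]
  congr 3
  ring

theorem comm_smul_mul {k l e f : T} {β : R} (s t : R) (hkl : l * k = k * l)
    (hel : e * l = β • (l * e)) (hfk : f * k = β • (k * f)) :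
    (s • (k * e)) * (t • (l * f)) - (t • (l * f)) * (s • (k * e)) =
      (s * t * β) • (k * l * (e * f - f * e)) := by
  have h1 : k * e * (l * f) = β • (k * l * (e * f)) := by
    calc k * e * (l * f) = k * (e * l) * f := by noncomm_ring
      _ = _ := by rw [hel]; simp only [mul_smul_comm, smul_mul_assoc, mul_assoc]
  have h2 : l * f * (k * e) = β • (k * l * (f * e)) := by
    calc l * f * (k * e) = l * (f * k) * e := by noncomm_ring
      _ = β • (l * k * (f * e)) := by
        rw [hfk]; simp only [mul_smul_comm, smul_mul_assoc, mul_assoc]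
      _ = _ := by rw [hkl]
  rw [smul_mul_smul_comm, smul_mul_smul_comm, h1, h2, mul_sub, smul_sub, smul_smul, smul_smul,
    mul_comm t s]

/-- The quantum Serre relation for sums of skew-commuting elements. -/
theorem serre_add {X Y Z W : T} {q p : R} (hqp : q * p = 1)
    (hYX : Y * X = (q * q) • (X * Y)) (hYZ : Y * Z = p • (Z * Y)) (hWX : W * X = p • (X * W))
    (hXZ : X ^ 2 * Z - (q + p) • (X * Z * X) + Z * X ^ 2 = 0)
    (hYW : Y ^ 2 * W - (q + p) • (Y * W * Y) + W * Y ^ 2 = 0) :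
    (X + Y) ^ 2 * (Z + W) - (q + p) • ((X + Y) * (Z + W) * (X + Y)) + (Z + W) * (X + Y) ^ 2 =
      0 := by
  -- The mixed monomials are reduced to the normal forms $XZY$, $ZXY$, $XYW$, $XWY$, $XXW$, $ZYY$;
  -- after that every coefficient cancels by $qp=1$, leaving only the two pure Serre relations.
  have e1 : X * Y * Z = p • (X * Z * Y) := by
    rw [mul_assoc, hYZ, mul_smul_comm, ← mul_assoc]
  have e2 : Y * X * Z = q • (X * Z * Y) := by
    rw [hYX, smul_mul_assoc, e1, smul_smul, mul_assoc, hqp, mul_one]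
  have e3 : Y * Z * X = q • (Z * X * Y) := by
    rw [hYZ, smul_mul_assoc, mul_assoc, hYX, mul_smul_comm, smul_smul, ← mul_assoc p, mul_comm p,
      hqp, one_mul, mul_assoc]
  have e4 : Z * Y * X = (q * q) • (Z * X * Y) := by
    rw [mul_assoc, hYX, mul_smul_comm, mul_assoc]
  have e5 : Y * X * W = (q * q) • (X * Y * W) := by rw [hYX, smul_mul_assoc]
  have e6 : Y * W * X = q • (X * Y * W) := by
    rw [mul_assoc, hWX, mul_smul_comm, ← mul_assoc, e5, smul_smul, ← mul_assoc p, mul_comm p, hqp,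
      one_mul]
  have e7 : W * X * Y = p • (X * W * Y) := by rw [hWX, smul_mul_assoc]
  have e8 : W * Y * X = q • (X * W * Y) := by
    rw [mul_assoc, hYX, mul_smul_comm, ← mul_assoc, e7, smul_smul, mul_assoc, hqp, mul_one]
  have e9 : X * W * X = p • (X * X * W) := by
    rw [mul_assoc, hWX, mul_smul_comm, ← mul_assoc]
  have e10 : W * X * X = (p * p) • (X * X * W) := by
    rw [hWX, smul_mul_assoc, e9, smul_smul]
  have e11 : Y * Z * Y = p • (Z * Y * Y) := by rw [hYZ, smul_mul_assoc]
  have e12 : Y * Y * Z = (p * p) • (Z * Y * Y) := by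
    rw [mul_assoc, hYZ, mul_smul_comm, ← mul_assoc, e11, smul_smul]
  rw [pow_two, ← mul_assoc Z] at hXZ
  rw [pow_two, ← mul_assoc W] at hYW
  rw [pow_two]
  simp only [add_mul, mul_add, ← mul_assoc, e1, e2, e3, e4, e5, e6, e7, e8, e9, e10, e11, e12]
  linear_combination (norm := module) hXZ + hYW - hqp • (Z * X * Y) - hqp • (X * Y * W) -
    hqp • (X * X * W) - hqp • (Z * Y * Y)

end SerreAlgebra

/-! ### Antipodes and counit: compatibility with the defining relations. -/

namespace Uq

variable {N : ℕ}

theorem E_mul_qH (x : Cartan N) (j : Fin N) :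
    E j * qH x = qs (-simpleRoot j x) • (qH x * E j) := by
  rw [qH_mul_E, smul_smul, mul_comm, qs_mul_qs_neg, one_smul]

theorem F_mul_qH (x : Cartan N) (j : Fin N) :
    F j * qH x = qs (simpleRoot j x) • (qH x * F j) := by
  rw [qH_mul_F, smul_smul, qs_mul_qs_neg, one_smul]

theorem commute_EF_qH (x : Cartan N) (i : Fin N) :
    Commute (E i * F i - F i * E i) (qH x) := by
  have h1 : Commute (E i * F i) (qH x) := by
    rw [Commute, SemiconjBy, mul_assoc, F_mul_qH, mul_smul_comm, ← mul_assoc, E_mul_qH,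
      smul_mul_assoc, smul_smul, qs_mul_qs_neg, one_smul, mul_assoc]
  have h2 : Commute (F i * E i) (qH x) := by
    rw [Commute, SemiconjBy, mul_assoc, E_mul_qH, mul_smul_comm, ← mul_assoc, F_mul_qH,
      smul_mul_assoc, smul_smul, mul_comm (qs _), qs_mul_qs_neg, one_smul, mul_assoc]
  exact h1.sub_left h2

section antipode

variable {u v : Kh} {x : Fin N → Cartan N}

theorem antipode_EF (huv : u * v = 1) (hx : ∀ i j, simpleRoot j (x i) = simpleRoot i (x j))
    (i j : Fin N) :
    -(v • (F j * qH (-x j))) * -(u • (qH (x i) * E i)) -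
        -(u • (qH (x i) * E i)) * -(v • (F j * qH (-x j))) =
      qH (x i) * (F j * E i - E i * F j) * qH (-x j) := by
  have h : F j * qH (-x j) * (qH (x i) * E i) = qH (x i) * (F j * E i) * qH (-x j) := by
    calc F j * qH (-x j) * (qH (x i) * E i) = F j * (qH (-x j) * qH (x i)) * E i := by
          simp only [mul_assoc]
      _ = (F j * qH (x i)) * (qH (-x j) * E i) := by
          rw [commute_qH]; simp only [mul_assoc]
      _ = _ := by
          rw [F_mul_qH, qH_mul_E, smul_mul_smul_comm, map_neg, hx, qs_mul_qs_neg, one_smul]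
          simp only [mul_assoc]
  rw [neg_mul_neg, neg_mul_neg, smul_mul_smul_comm, smul_mul_smul_comm, mul_comm v, huv, one_smul,
    one_smul, h, mul_sub, sub_mul]
  simp only [mul_assoc]

/-- Stated with parameters to cover two antipodes: $u=v=1$, $x_i=h_{\alpha_i}$ for the standard
structure, and $u=q$, $v=q^{-1}$, $x_i=0$ for the twisted one. The symmetry of $\alpha_j(x_i)$ makes
the scalars from reordering agree. -/
theorem antipode_relations (huv : u * v = 1)
    (hx : ∀ i j, simpleRoot j (x i) = simpleRoot i (x j)) :
    Relations (T := (Uq N)ᵐᵒᵖ) (fun i => MulOpposite.op (-H (coroot i)))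
      (fun i => MulOpposite.op (-(u • (qH (x i) * E i))))
      (fun i => MulOpposite.op (-(v • (F i * qH (-x i))))) where
  hh i j := by
    simp only [← MulOpposite.op_mul, ← MulOpposite.op_sub, MulOpposite.op_eq_zero_iff, neg_mul_neg]
    exact relations.hh j i
  he i j := by
    simp only [← MulOpposite.op_mul, ← MulOpposite.op_sub, ← MulOpposite.op_smul, neg_mul_neg]
    congr 1
    have h : H (coroot i) * E j - E j * H (coroot i) = _ := relations.he i j
    rw [sub_eq_iff_eq_add] at h
    rw [mul_smul_comm, smul_mul_assoc, ← mul_assoc, ← commute_qH_H, mul_assoc, mul_assoc, h]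
    simp only [mul_add, smul_add, mul_smul_comm, smul_neg]
    rw [smul_comm u]
    abel
  hf i j := by
    simp only [← MulOpposite.op_mul, ← MulOpposite.op_sub, ← MulOpposite.op_smul, neg_mul_neg,
      ← MulOpposite.op_neg]
    congr 1
    have h : H (coroot i) * F j - F j * H (coroot i) = _ := relations.hf i j
    rw [sub_eq_iff_eq_add] at h
    rw [mul_smul_comm, smul_mul_assoc, ← mul_assoc, mul_assoc (F j), commute_qH_H, ← mul_assoc, h]
    simp only [add_mul, neg_mul, smul_add, smul_mul_assoc, smul_neg]
    rw [smul_comm v]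
    abel
  ef_same i := by
    rw [← op_hqdiff, hqdiff_neg, ← relations.ef_same]
    simp only [← MulOpposite.op_mul, ← MulOpposite.op_sub, ← MulOpposite.op_smul]
    rw [antipode_EF huv hx, ← neg_sub (E i * F i), mul_neg, neg_mul, smul_neg,
      ← (commute_EF_qH (x i) i).eq, mul_assoc, qH_mul_qH_neg, mul_one]
  ef_ne i j hij := by
    simp only [← MulOpposite.op_mul, ← MulOpposite.op_sub, MulOpposite.op_eq_zero_iff]
    rw [antipode_EF huv hx, ← neg_sub (E i * F j), relations.ef_ne i j hij]
    simp
  serre_e i j hij := by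
    simp only [← MulOpposite.op_mul, ← MulOpposite.op_pow, ← MulOpposite.op_sub,
      ← MulOpposite.op_smul, ← MulOpposite.op_add, MulOpposite.op_eq_zero_iff, ← neg_smul]
    have h := serre_smul_mul (qK + qKinv) (-u) (-u) (commute_qH (x j) (x i)).eq
      (E_mul_qH (x i) i) (E_mul_qH (x j) i) (by rw [E_mul_qH (x i) j, hx])
    rw [relations.serre_e i j hij, mul_zero, smul_zero] at h
    rw [← h, ← mul_assoc]
    abel
  serre_f i j hij := by
    simp only [← MulOpposite.op_mul, ← MulOpposite.op_pow, ← MulOpposite.op_sub,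
      ← MulOpposite.op_smul, ← MulOpposite.op_add, MulOpposite.op_eq_zero_iff, ← neg_smul,
      F_mul_qH, smul_smul]
    have h := serre_smul_mul (qK + qKinv) (-(v * qs (simpleRoot i (-x i))))
      (-(v * qs (simpleRoot j (-x j)))) (commute_qH (-x j) (-x i)).eq
      (F_mul_qH (-x i) i) (F_mul_qH (-x j) i) (by rw [F_mul_qH (-x i) j, map_neg, map_neg, hx])
    rw [relations.serre_f i j hij, mul_zero, smul_zero] at h
    rw [← h, ← mul_assoc]
    abel
  comm_e i j hij := by
    simp only [← MulOpposite.op_mul, ← MulOpposite.op_sub, MulOpposite.op_eq_zero_iff, ← neg_smul]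
    rw [comm_smul_mul _ _ (commute_qH (x i) (x j)).eq (E_mul_qH (x i) j)
      (by rw [E_mul_qH (x j) i, hx]), ← neg_sub (E i * E j), relations.comm_e i j hij]
    simp
  comm_f i j hij := by
    simp only [← MulOpposite.op_mul, ← MulOpposite.op_sub, MulOpposite.op_eq_zero_iff, ← neg_smul,
      F_mul_qH, smul_smul]
    rw [comm_smul_mul _ _ (commute_qH (-x i) (-x j)).eq (F_mul_qH (-x i) j)
      (by rw [F_mul_qH (-x j) i, map_neg, map_neg, hx]), ← neg_sub (F i * F j),
      relations.comm_f i j hij]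
    simp

end antipode

theorem counit_relations : Relations (N := N) (T := Kh) (fun _ => 0) (fun _ => 0) (fun _ => 0) where
  hh _ _ := by simp
  he _ _ := by simp
  hf _ _ := by simp
  ef_same _ := by simp [hqdiff_zero]
  ef_ne _ _ _ := by simp
  serre_e _ _ _ := by simp
  serre_f _ _ _ := by simp
  comm_e _ _ _ := by simp
  comm_f _ _ _ := by simp

end Uq

section

open HC

variable {A : Type*} [Ring A] [Algebra Kh A]
variable {B : Type*} [Ring B] [Algebra Kh B]

theorem HC.of_tmul_one_hqdiff [HComplete A] (x : A) :
    (of (hqdiff x ⊗ₜ 1) : Tensor A B) = hqdiff (of (x ⊗ₜ 1)) := by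
  have := map_hqdiff ((of : A ⊗[Kh] B →ₐ[Kh] _).comp
    (Algebra.TensorProduct.includeLeft : A →ₐ[Kh] A ⊗[Kh] B)) x
  simpa only [AlgHom.comp_apply, Algebra.TensorProduct.includeLeft_apply] using this

theorem HC.of_one_tmul_hqdiff [HComplete B] (x : B) :
    (of (1 ⊗ₜ hqdiff x) : Tensor A B) = hqdiff (of (1 ⊗ₜ x)) := by
  have := map_hqdiff ((of : A ⊗[Kh] B →ₐ[Kh] _).comp
    (Algebra.TensorProduct.includeRight : B →ₐ[Kh] A ⊗[Kh] B)) x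
  simpa only [AlgHom.comp_apply, Algebra.TensorProduct.includeRight_apply] using this

end

/-! ### The standard coproduct respects the relations; existence of the standard structure. -/

namespace Uq

open HC

variable {N : ℕ}

theorem cartanMatrix_self (i : Fin N) : CartanMatrix.A N i i = 2 := by
  simp [CartanMatrix.A]

theorem cartanMatrix_adj {i j : Fin N} (hij : i.val + 1 = j.val ∨ j.val + 1 = i.val) :
    CartanMatrix.A N i j = -1 := by
  have : i ≠ j := by rintro rfl; omega
  simp [CartanMatrix.A, this, hij]

theorem cartanMatrix_not_adj {i j : Fin N} (h : i ≠ j)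
    (hij : ¬(i.val + 1 = j.val ∨ j.val + 1 = i.val)) : CartanMatrix.A N i j = 0 := by
  simp [CartanMatrix.A, h, hij]

theorem qs_two : qs 2 = qK * qK := by
  rw [← qs_one, ← qs_add]
  norm_num

/-- The value of the standard coproduct on `h_{α_i}`. -/
def comulH (i : Fin N) : Uq N ⊗[Kh] Uq N := H (coroot i) ⊗ₜ 1 + 1 ⊗ₜ H (coroot i)

/-- The value of the standard coproduct on `e_{α_i}`. -/
def comulE (i : Fin N) : Uq N ⊗[Kh] Uq N := qH (-coroot i) ⊗ₜ E i + E i ⊗ₜ 1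

/-- The value of the standard coproduct on `e_{-α_i}`. -/
def comulF (i : Fin N) : Uq N ⊗[Kh] Uq N := F i ⊗ₜ qH (coroot i) + 1 ⊗ₜ F i

/-- The cross terms $q^{-h_{\alpha_i}}e_{-\alpha_j}\otimes e_{\alpha_i}q^{h_{\alpha_j}}$ cancel:
reordering the two factors gives $q^{a_{ij}}$ and $q^{-a_{ij}}$, by symmetry of the Cartan matrix.
-/
theorem comul_ef (i j : Fin N) : comulE i * comulF j - comulF j * comulE i =
    qH (-coroot i) ⊗ₜ (E i * F j - F j * E i) + (E i * F j - F j * E i) ⊗ₜ qH (coroot j) := by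
  have h : (qH (-coroot i) * F j) ⊗ₜ[Kh] (E i * qH (coroot j)) =
      (F j * qH (-coroot i)) ⊗ₜ (qH (coroot j) * E i) := by
    rw [qH_mul_F, E_mul_qH, TensorProduct.smul_tmul_smul, map_neg, neg_neg, simpleRoot_coroot,
      simpleRoot_coroot, cartanMatrix_symm i j, qs_mul_qs_neg, one_smul]
  simp only [comulE, comulF, add_mul, mul_add, Algebra.TensorProduct.tmul_mul_tmul, h, mul_one,
    one_mul, TensorProduct.tmul_sub, TensorProduct.sub_tmul]
  abel

theorem comul_H_comm (i : Fin N) {a b : Uq N} {c : ℤ}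
    (hx : H (coroot i) * a - a * H (coroot i) = c • a)
    {y : Cartan N} (hb : b = qH y) :
    comulH i * (a ⊗ₜ b) - (a ⊗ₜ b) * comulH i = c • (a ⊗ₜ b) ∧
      comulH i * (b ⊗ₜ a) - (b ⊗ₜ a) * comulH i = c • (b ⊗ₜ a) := by
  have hb' : b * H (coroot i) = H (coroot i) * b := by rw [hb]; exact commute_qH_H _ _
  have hx' := sub_eq_iff_eq_add.1 hx
  constructor <;>
  · simp only [comulH, add_mul, mul_add, Algebra.TensorProduct.tmul_mul_tmul, mul_one, one_mul, hb',
      hx', TensorProduct.add_tmul, TensorProduct.tmul_add, TensorProduct.smul_tmul',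
      TensorProduct.tmul_smul]
    abel

theorem comul_relations : Relations (T := Tensor (Uq N) (Uq N)) (fun i => of (comulH i))
    (fun i => of (comulE i)) (fun i => of (comulF i)) where
  hh i j := by
    have h : H (coroot i) * H (coroot j) = H (coroot j) * H (coroot i) := commute_H (N := N) _ _
    rw [← map_mul, ← map_mul, ← map_sub, ← map_zero of]
    congr 1
    simp only [comulH, add_mul, mul_add, Algebra.TensorProduct.tmul_mul_tmul, h, mul_one, one_mul]
    abel
  he i j := by
    rw [← map_mul, ← map_mul, ← map_sub, ← map_zsmul]
    congr 1
    have h := relations.he i j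
    have h1 := (comul_H_comm i h (y := -coroot j) rfl).2
    have h2 := (comul_H_comm i h qH_zero.symm).1
    rw [comulE, smul_add, ← h1, ← h2, add_mul, mul_add]
    abel
  hf i j := by
    rw [← map_mul, ← map_mul, ← map_sub, ← neg_smul, ← map_zsmul]
    congr 1
    have h : H (coroot i) * F j - F j * H (coroot i) = -CartanMatrix.A N i j • F j := by
      rw [neg_smul]
      exact relations.hf i j
    have h1 := (comul_H_comm i h (y := coroot j) rfl).1
    have h2 := (comul_H_comm i h qH_zero.symm).2
    rw [comulF, smul_add, ← h1, ← h2, add_mul, mul_add]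
    abel
  ef_same i := by
    -- By `comul_ef` the left side is the expansion of `hqdiff_add` for $h_{\alpha_i}\otimes1$ and
    -- $1\otimes h_{\alpha_i}$.
    rw [← map_mul, ← map_mul, ← map_sub, comul_ef, ← map_smul, smul_add, ← TensorProduct.tmul_smul,
      TensorProduct.smul_tmul', relations.ef_same, comulH, map_add, map_add, hqdiff_add]
    · rw [← of_tmul_one_hqdiff, ← of_one_tmul_hqdiff, ← of_one_tmul_hexp, ← map_neg,
        ← TensorProduct.neg_tmul, ← of_tmul_one_hexp, ← map_mul, ← map_mul, ← H_neg, ← qH_eq,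
        ← qH_eq]
      simp only [Algebra.TensorProduct.tmul_mul_tmul, mul_one, one_mul]
      rw [add_comm]
    · rw [Commute, SemiconjBy, ← map_mul, ← map_mul]
      simp
  ef_ne i j hij := by
    rw [← map_mul, ← map_mul, ← map_sub, comul_ef, relations.ef_ne i j hij]
    simp
  serre_e i j hij := by
    rw [← map_mul, ← map_mul, ← map_pow, ← map_mul, ← map_mul, ← map_smul, ← map_sub, ← map_add,
      ← map_zero of]
    congr 1
    -- Here $X=q^{-h_{\alpha_i}}\otimes e_{\alpha_i}$, $Y=e_{\alpha_i}\otimes1$, and $Z,W$ are the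
    -- same for $j$; the exponents $2,-1,-1$ of the skew commutations are Cartan matrix entries.
    refine serre_add qK_mul_qKinv ?_ ?_ ?_ ?_ ?_
    · simp only [Algebra.TensorProduct.tmul_mul_tmul, mul_one, one_mul]
      rw [E_mul_qH, ← TensorProduct.smul_tmul', map_neg, neg_neg, simpleRoot_coroot,
        cartanMatrix_self, ← qs_two]
      norm_num
    · simp only [Algebra.TensorProduct.tmul_mul_tmul, mul_one, one_mul]
      rw [E_mul_qH, ← TensorProduct.smul_tmul', map_neg, neg_neg, simpleRoot_coroot,
        cartanMatrix_adj hij, ← qs_neg_one]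
      norm_num
    · simp only [Algebra.TensorProduct.tmul_mul_tmul, mul_one, one_mul]
      rw [E_mul_qH, ← TensorProduct.smul_tmul', map_neg, neg_neg, simpleRoot_coroot,
        cartanMatrix_adj hij.symm, ← qs_neg_one]
      norm_num
    · have h : qH (-coroot i) * qH (-coroot j) = qH (-coroot j) * qH (-coroot i) :=
        commute_qH (N := N) _ _
      have h0 := relations.serre_e i j hij
      rw [pow_two] at h0
      simp only [pow_two, Algebra.TensorProduct.tmul_mul_tmul, ← TensorProduct.tmul_smul]
      rw [← mul_assoc (qH (-coroot j)), ← h, mul_assoc (qH (-coroot i)) (qH (-coroot j)), ← h,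
        ← mul_assoc,
        ← TensorProduct.tmul_sub, ← TensorProduct.tmul_add, h0, TensorProduct.tmul_zero]
    · have h0 := relations.serre_e i j hij
      rw [pow_two] at h0
      simp only [pow_two, Algebra.TensorProduct.tmul_mul_tmul, TensorProduct.smul_tmul', mul_one]
      rw [← TensorProduct.sub_tmul, ← TensorProduct.add_tmul, h0, TensorProduct.zero_tmul]
  serre_f i j hij := by
    rw [← map_mul, ← map_mul, ← map_pow, ← map_mul, ← map_mul, ← map_smul, ← map_sub, ← map_add,
      ← map_zero of]
    congr 1
    refine serre_add qK_mul_qKinv ?_ ?_ ?_ ?_ ?_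
    · simp only [Algebra.TensorProduct.tmul_mul_tmul, mul_one, one_mul]
      rw [F_mul_qH, TensorProduct.tmul_smul, simpleRoot_coroot, cartanMatrix_self, ← qs_two]
      norm_num
    · simp only [Algebra.TensorProduct.tmul_mul_tmul, mul_one, one_mul]
      rw [F_mul_qH, TensorProduct.tmul_smul, simpleRoot_coroot, cartanMatrix_adj hij, ← qs_neg_one]
      norm_num
    · simp only [Algebra.TensorProduct.tmul_mul_tmul, mul_one, one_mul]
      rw [F_mul_qH, TensorProduct.tmul_smul, simpleRoot_coroot, cartanMatrix_adj hij.symm,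
        ← qs_neg_one]
      norm_num
    · have h : qH (coroot i) * qH (coroot j) = qH (coroot j) * qH (coroot i) :=
        commute_qH (N := N) _ _
      have h0 := relations.serre_f i j hij
      rw [pow_two] at h0
      simp only [pow_two, Algebra.TensorProduct.tmul_mul_tmul, TensorProduct.smul_tmul']
      rw [← mul_assoc (qH (coroot j)), ← h, mul_assoc (qH (coroot i)) (qH (coroot j)), ← h,
        ← mul_assoc,
        ← TensorProduct.sub_tmul, ← TensorProduct.add_tmul, h0, TensorProduct.zero_tmul]
    · have h0 := relations.serre_f i j hij
      rw [pow_two] at h0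
      simp only [pow_two, Algebra.TensorProduct.tmul_mul_tmul, ← TensorProduct.tmul_smul, mul_one]
      rw [← TensorProduct.tmul_sub, ← TensorProduct.tmul_add, h0, TensorProduct.tmul_zero]
  comm_e i j hij := by
    rw [← map_mul, ← map_mul, ← map_sub, ← map_zero of]
    congr 1
    -- Non-adjacency includes $i=j$, where the Cartan entry is $2$ instead of $0$ but the commutator
    -- is trivially zero.
    rcases eq_or_ne i j with rfl | hne
    · exact sub_self _
    have h0 := sub_eq_zero.1 (relations.comm_e i j hij)
    simp only [comulE, add_mul, mul_add, Algebra.TensorProduct.tmul_mul_tmul, mul_one, one_mul, h0,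
      E_mul_qH, map_neg, simpleRoot_coroot, cartanMatrix_not_adj hne hij,
      cartanMatrix_not_adj hne.symm (fun h => hij h.symm), (commute_qH (-coroot i) (-coroot j)).eq]
    simp only [Int.cast_zero, neg_zero, qs_zero, one_smul]
    abel
  comm_f i j hij := by
    rw [← map_mul, ← map_mul, ← map_sub, ← map_zero of]
    congr 1
    rcases eq_or_ne i j with rfl | hne
    · exact sub_self _
    have h0 := sub_eq_zero.1 (relations.comm_f i j hij)
    simp only [comulF, add_mul, mul_add, Algebra.TensorProduct.tmul_mul_tmul, mul_one, one_mul, h0,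
      F_mul_qH, simpleRoot_coroot, cartanMatrix_not_adj hne hij,
      cartanMatrix_not_adj hne.symm (fun h => hij h.symm), (commute_qH (coroot i) (coroot j)).eq]
    simp only [Int.cast_zero, qs_zero, one_smul]
    abel

theorem exists_isStandard : ∃ 𝓗 : TopHopf (Uq N), IsStandard 𝓗 := by
  have hx : ∀ i j : Fin N, simpleRoot j (coroot i) = simpleRoot i (coroot j) := fun i j => by
    rw [simpleRoot_coroot, simpleRoot_coroot, cartanMatrix_symm]
  have rel := antipode_relations (N := N) (mul_one 1) hx
  have hΔ : IsSkewPrimitive (lift (comul_relations (N := N))) (fun i => -coroot i) 0 coroot 0 :=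
    { h := lift_h _
      e := fun i => (lift_e _ i).trans (by rw [comulE, Pi.zero_apply, qH_zero])
      f := fun i => (lift_f _ i).trans (by rw [comulF, Pi.zero_apply, qH_zero]) }
  have hS : IsSkewAntipode (lift rel) (fun i => -coroot i) 0 coroot 0 :=
    { h := lift_h _
      e := fun i => (lift_e _ i).trans (by simp [qH_zero])
      f := fun i => (lift_f _ i).trans (by simp [qH_zero]) }
  have hε := counit_relations (N := N)
  refine ⟨hopfOfSkewPrimitive hΔ (lift_h hε) (lift_e hε) (lift_f hε) hS,
    lift_h comul_relations, lift_e comul_relations, lift_f comul_relations, fun i => ?_,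
    fun i => ?_, fun i => ?_, lift_h hε, lift_e hε, lift_f hε⟩
  · change (lift rel _).unop = _
    rw [lift_h, MulOpposite.unop_op]
  · change (lift rel _).unop = _
    rw [lift_e, MulOpposite.unop_op, one_smul]
  · change (lift rel _).unop = _
    rw [lift_f, MulOpposite.unop_op, one_smul]

end Uq

/-! ### Conjugation by $q^r$ and the twisted Hopf algebra. -/

section

variable {T : Type*} [Ring T] [Algebra Kh T] [HComplete T]

/-- The hypothesis reads $X(R+D)=RX$, and the exponential of $\hbar(R+D)$ splits because $R$ and $D$
commute. Applied with $R=r$, $X=1\otimes g$ or $g\otimes1$, and $D$ the contraction of $r$ with the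
weight of $g$. -/
theorem hexp_mul_of_commutator {R X D : T} (h : R * X - X * R = X * D) (hRD : Commute R D) :
    hexp R * X = X * hexp D * hexp R := by
  have h1 : SemiconjBy X (R + D) R := by
    rw [SemiconjBy, mul_add, ← h]
    abel
  rw [← h1.hexp_right.eq, add_comm R D, hexp_add hRD.symm, mul_assoc]

end

section

variable {T : Type*} [Ring T] [Algebra Kh T]

/-- Conjugation by an invertible element. -/
def conjAlg {k k' : T} (h : k * k' = 1) (h' : k' * k = 1) : T →ₐ[Kh] T :=
  AlgHom.ofLinearMap (LinearMap.mulLeft Kh k ∘ₗ LinearMap.mulRight Kh k') (by simp [h]) fun x y => by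
    simp only [LinearMap.comp_apply, LinearMap.mulLeft_apply, LinearMap.mulRight_apply, mul_assoc]
    rw [← mul_assoc k' k, h', one_mul]

theorem conjAlg_eq {k k' : T} (h : k * k' = 1) (h' : k' * k = 1) {x y : T}
    (hxy : k * x = y * k) : conjAlg h h' x = y := by
  change k * (x * k') = y
  rw [← mul_assoc, hxy, mul_assoc, h, mul_one]

theorem conjAlg_mul {k k' : T} (h : k * k' = 1) (h' : k' * k = 1) (x : T) :
    conjAlg h h' x * k = k * x := by
  change k * (x * k') * k = _
  rw [mul_assoc, mul_assoc, h', mul_one]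

end

namespace Uq

open HC

variable {N : ℕ}

/-- The coordinates of an element of `𝔥 ⊗ 𝔥`. -/
def coords (r : Cartan N ⊗[ℂ] Cartan N) (i j : Fin N) : ℂ :=
  ((Pi.basisFun ℂ (Fin N)).tensorProduct (Pi.basisFun ℂ (Fin N))).repr r (i, j)

/-- The contraction of the right factor with a linear form. -/
def contrRight (r : Cartan N ⊗[ℂ] Cartan N) (l : Fin N → ℂ) : Cartan N :=
  fun i => ∑ j, coords r i j * l j

/-- The contraction of the left factor with a linear form. -/
def contrLeft (r : Cartan N ⊗[ℂ] Cartan N) (l : Fin N → ℂ) : Cartan N :=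
  fun j => ∑ i, coords r i j * l i

/-- `g` has weight `l`. -/
def HasWeight (g : Uq N) (l : Fin N → ℂ) : Prop :=
  ∀ i, H (coroot i) * g - g * H (coroot i) = PowerSeries.C (l i) • g

theorem hasWeight_E (j : Fin N) : HasWeight (E j) fun i => (CartanMatrix.A N j i : ℂ) :=
  fun i => by rw [H_mul_E, simpleRoot_coroot]

theorem hasWeight_F (j : Fin N) : HasWeight (F j) fun i => -(CartanMatrix.A N j i : ℂ) :=
  fun i => by rw [H_mul_F, simpleRoot_coroot]

variable (r : Cartan N ⊗[ℂ] Cartan N)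

theorem commute_HH_left (x : Cartan N) : Commute (HH r) (H x ⊗ₜ[Kh] 1) := by
  refine Commute.sum_left _ _ _ fun i _ => Commute.sum_left _ _ _ fun j _ => Commute.smul_left ?_ _
  rw [Commute, SemiconjBy, Algebra.TensorProduct.tmul_mul_tmul,
    Algebra.TensorProduct.tmul_mul_tmul, mul_one, one_mul, commute_H]

theorem commute_HH_right (x : Cartan N) : Commute (HH r) (1 ⊗ₜ[Kh] H x) := by
  refine Commute.sum_left _ _ _ fun i _ => Commute.sum_left _ _ _ fun j _ => Commute.smul_left ?_ _
  rw [Commute, SemiconjBy, Algebra.TensorProduct.tmul_mul_tmul,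
    Algebra.TensorProduct.tmul_mul_tmul, mul_one, one_mul, commute_H]

theorem HH_mul_right {g : Uq N} {l : Fin N → ℂ} (hg : HasWeight g l) :
    HH r * (1 ⊗ₜ g) - (1 ⊗ₜ g) * HH r = (1 ⊗ₜ g) * (H (contrRight r l) ⊗ₜ 1) := by
  rw [HH, H_eq, Finset.sum_mul, Finset.mul_sum, ← Finset.sum_sub_distrib, TensorProduct.sum_tmul,
    Finset.mul_sum]
  refine Finset.sum_congr rfl fun i _ => ?_
  rw [Finset.sum_mul, Finset.mul_sum, ← Finset.sum_sub_distrib, contrRight, map_sum,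
    Finset.sum_smul, TensorProduct.sum_tmul, Finset.mul_sum]
  refine Finset.sum_congr rfl fun j _ => ?_
  simp only [smul_mul_assoc, mul_smul_comm, Algebra.TensorProduct.tmul_mul_tmul, one_mul, mul_one,
    ← smul_sub, ← TensorProduct.tmul_sub, hg j, map_mul, mul_smul, TensorProduct.tmul_smul,
    ← TensorProduct.smul_tmul']
  rfl

theorem HH_mul_left {g : Uq N} {l : Fin N → ℂ} (hg : HasWeight g l) :
    HH r * (g ⊗ₜ 1) - (g ⊗ₜ 1) * HH r = (g ⊗ₜ 1) * (1 ⊗ₜ H (contrLeft r l)) := by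
  rw [HH, Finset.sum_comm, H_eq, Finset.sum_mul, Finset.mul_sum, ← Finset.sum_sub_distrib,
    TensorProduct.tmul_sum, Finset.mul_sum]
  refine Finset.sum_congr rfl fun j _ => ?_
  rw [Finset.sum_mul, Finset.mul_sum, ← Finset.sum_sub_distrib, contrLeft, map_sum,
    Finset.sum_smul, TensorProduct.tmul_sum, Finset.mul_sum]
  refine Finset.sum_congr rfl fun i _ => ?_
  simp only [smul_mul_assoc, mul_smul_comm, Algebra.TensorProduct.tmul_mul_tmul, one_mul, mul_one,
    ← smul_sub, ← TensorProduct.sub_tmul, hg i, map_mul, mul_smul, TensorProduct.tmul_smul,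
    ← TensorProduct.smul_tmul']
  rfl

theorem commute_of {A : Type*} [Ring A] [Algebra Kh A] {x y : A} (h : Commute x y) :
    Commute (of x) (of y) := by
  rw [Commute, SemiconjBy, ← map_mul, h.eq, map_mul]

theorem hexp_HH_mul_right {g : Uq N} {l : Fin N → ℂ} (hg : HasWeight g l) (a : Cartan N) :
    hexp (of (HH r)) * of (qH a ⊗ₜ g) = of (qH (a + contrRight r l) ⊗ₜ g) * hexp (of (HH r)) := by
  have h1 : hexp (of (HH r)) * of (1 ⊗ₜ g) =
      of (1 ⊗ₜ g) * of (qH (contrRight r l) ⊗ₜ 1) * hexp (of (HH r)) := by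
    rw [qH_eq, of_tmul_one_hexp]
    refine hexp_mul_of_commutator ?_ (commute_of (commute_HH_left r _))
    rw [← map_mul, ← map_mul, ← map_sub, ← map_mul, HH_mul_right r hg]
  have h2 : Commute (hexp (of (HH r))) (of (qH a ⊗ₜ 1)) := by
    rw [qH_eq, of_tmul_one_hexp]
    exact (commute_of (commute_HH_left r _)).hexp_left.hexp_right
  have h3 : (qH a ⊗ₜ g : Uq N ⊗[Kh] Uq N) = (qH a ⊗ₜ 1) * (1 ⊗ₜ g) := by simp
  rw [h3, map_mul, ← mul_assoc, h2.eq, mul_assoc, h1, ← mul_assoc, ← map_mul, ← map_mul, qH_add]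
  simp

theorem hexp_HH_mul_left {g : Uq N} {l : Fin N → ℂ} (hg : HasWeight g l) (a : Cartan N) :
    hexp (of (HH r)) * of (g ⊗ₜ qH a) = of (g ⊗ₜ qH (a + contrLeft r l)) * hexp (of (HH r)) := by
  have h1 : hexp (of (HH r)) * of (g ⊗ₜ 1) =
      of (g ⊗ₜ 1) * of (1 ⊗ₜ qH (contrLeft r l)) * hexp (of (HH r)) := by
    rw [qH_eq, of_one_tmul_hexp]
    refine hexp_mul_of_commutator ?_ (commute_of (commute_HH_right r _))
    rw [← map_mul, ← map_mul, ← map_sub, ← map_mul, HH_mul_left r hg]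
  have h2 : Commute (hexp (of (HH r))) (of (1 ⊗ₜ qH a)) := by
    rw [qH_eq, of_one_tmul_hexp]
    exact (commute_of (commute_HH_right r _)).hexp_left.hexp_right
  have h3 : (g ⊗ₜ qH a : Uq N ⊗[Kh] Uq N) = (1 ⊗ₜ qH a) * (g ⊗ₜ 1) := by simp
  rw [h3, map_mul, ← mul_assoc, h2.eq, mul_assoc, h1, ← mul_assoc, ← map_mul, ← map_mul, qH_add]
  simp

variable {r} in
/-- The twist of the standard structure by `q^r`, where the contractions of `r` with the simple roots
are such that the antipode acts on the Chevalley generators by scalars. -/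
theorem exists_twist {𝓗 : TopHopf (Uq N)} (h𝓗 : IsStandard 𝓗) {b : Fin N → Cartan N}
    (hb : ∀ j, contrLeft r (fun i => (CartanMatrix.A N j i : ℂ)) = b j)
    (hb' : ∀ j, contrRight r (fun i => (CartanMatrix.A N j i : ℂ)) = coroot j - b j)
    (hb1 : ∀ j, simpleRoot j (b j) = 1) :
    ∃ (𝓗K : TopHopf (Uq N)) (S : Uq N →ₐ[Kh] (Uq N)ᵐᵒᵖ),
      TopHopf.IsTwist 𝓗 (qpow (HH r)) 𝓗K ∧
      IsSkewPrimitive 𝓗K.comul (fun i => -b i) b (fun i => coroot i - b i)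
        (fun i => -(coroot i - b i)) ∧
      𝓗K.antipode = unopLinear S ∧
      (∀ i, S (H (coroot i)) = MulOpposite.op (-H (coroot i))) ∧
      (∀ i, S (E i) = MulOpposite.op (-(qs 1 • E i))) ∧
      (∀ i, S (F i) = MulOpposite.op (-(qs (-1) • F i))) := by
  have hneg : ∀ l, contrLeft r (fun i => -l i) = -contrLeft r l := fun l => by
    funext i
    simp [contrLeft]
  have hneg' : ∀ l, contrRight r (fun i => -l i) = -contrRight r l := fun l => by
    funext i
    simp [contrRight]
  have hK := hexp_mul_hexp_neg (of (HH r))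
  have hK' := hexp_neg_mul_hexp (of (HH r))
  -- The exponents are old exponent plus contraction: $-h_{\alpha_i}+(h_{\alpha_i}-b_i)=-b_i$ and
  -- $b_i$ for $e_{\alpha_i}$. For $e_{-\alpha_i}$ the weight changes sign, giving
  -- $h_{\alpha_i}-b_i$ and $-(h_{\alpha_i}-b_i)$.
  have hΔ : IsSkewPrimitive ((conjAlg hK hK').comp 𝓗.comul) (fun i => -b i) b
      (fun i => coroot i - b i) (fun i => -(coroot i - b i)) := by
    refine ⟨fun i => ?_, fun i => ?_, fun i => ?_⟩
    · rw [AlgHom.comp_apply, h𝓗.comul_h]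
      refine conjAlg_eq _ _ ?_
      exact (commute_of ((commute_HH_left r _).add_right (commute_HH_right r _))).hexp_left
    · rw [AlgHom.comp_apply, h𝓗.comul_e]
      refine conjAlg_eq _ _ ?_
      rw [map_add, map_add, mul_add, add_mul, hexp_HH_mul_right r (hasWeight_E i),
        ← qH_zero, hexp_HH_mul_left r (hasWeight_E i), hb, hb', zero_add]
      congr 5
      abel
    · rw [AlgHom.comp_apply, h𝓗.comul_f]
      refine conjAlg_eq _ _ ?_
      rw [map_add, map_add, mul_add, add_mul, hexp_HH_mul_left r (hasWeight_F i),
        ← qH_zero, hexp_HH_mul_right r (hasWeight_F i), hneg, hneg', hb, hb', zero_add,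
        ← sub_eq_add_neg]
  have rel := antipode_relations (N := N) (x := fun _ => 0) (qs_mul_qs_neg 1) (by simp)
  have hSE : ∀ i, lift rel (E i) = MulOpposite.op (-(qs 1 • E i)) := fun i =>
    (lift_e rel i).trans (by rw [qH_zero, one_mul])
  have hSF : ∀ i, lift rel (F i) = MulOpposite.op (-(qs (-1) • F i)) := fun i =>
    (lift_f rel i).trans (by rw [neg_zero, qH_zero, mul_one])
  -- The general formula gives $-q^{b_i}e_{\alpha_i}q^{-b_i}$, which is $-q\,e_{\alpha_i}$ because
  -- $\alpha_i(b_i)=1$; for $e_{-\alpha_i}$ the exponent is $-\alpha_i(h_{\alpha_i}-b_i)=-(2-1)$.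
  have hS : IsSkewAntipode (lift rel) (fun i => -b i) b (fun i => coroot i - b i)
      (fun i => -(coroot i - b i)) := by
    refine ⟨lift_h rel, fun i => ?_, fun i => ?_⟩
    · rw [hSE, neg_neg, qH_mul_E, smul_mul_assoc, mul_assoc, qH_mul_qH_neg, mul_one, hb1]
    · rw [hSF, neg_neg, qH_mul_F, smul_mul_assoc, mul_assoc, qH_mul_qH_neg, mul_one, map_sub, hb1,
        simpleRoot_coroot, cartanMatrix_self]
      norm_num
  refine ⟨hopfOfSkewPrimitive hΔ h𝓗.counit_h h𝓗.counit_e h𝓗.counit_f hS, lift rel, ⟨?_, ?_, rfl⟩,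
    hΔ, rfl, lift_h rel, hSE, hSF⟩
  · rw [qpow_eq]
    exact ⟨⟨_, _, hK, hK'⟩, rfl⟩
  · intro a
    rw [qpow_eq]
    exact conjAlg_mul hK hK' _

end Uq

/-! ### Closed subalgebras and their completed tensor squares. -/

section

open HC

variable {A : Type*} [Ring A] [Algebra Kh A]

theorem map_eq_of_mem_closedAdjoin {s : Set A} {T : Type*} [Ring T] [Algebra Kh T] [HComplete T]
    {φ ψ : A →ₐ[Kh] T} (h : ∀ x ∈ s, φ x = ψ x) {x : A} (hx : x ∈ closedAdjoin s) : φ x = ψ x := by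
  refine HComplete.eq_of_forall fun n => ?_
  obtain ⟨y, hy, z, hz⟩ := hx n
  have h1 : φ y = ψ y := by
    have : Algebra.adjoin Kh s ≤ AlgHom.equalizer φ ψ := Algebra.adjoin_le h
    exact this hy
  refine ⟨φ z - ψ z, ?_⟩
  rw [smul_sub, ← map_smul, ← map_smul, ← hz, map_sub, map_sub, h1]
  abel

theorem subset_closedAdjoin {s : Set A} {x : A} (hx : x ∈ Algebra.adjoin Kh s) :
    x ∈ closedAdjoin s :=
  fun n => ⟨x, hx, by rw [sub_self]; exact zero_mem _⟩

theorem mem_closedAdjoin_of_isHSum {s : Set A} {t : ℕ → A} {x : A} (hx : IsHSum t x)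
    (ht : ∀ n, t n ∈ Algebra.adjoin Kh s) : x ∈ closedAdjoin s := by
  intro n
  obtain ⟨y, hy⟩ := hx n
  refine ⟨∑ m ∈ Finset.range n, hbar ^ m • t m,
    sum_mem fun m _ => Subalgebra.smul_mem _ (ht m) _, y, ?_⟩
  rw [hy, add_sub_cancel_left]

theorem mem_closedAdjoin_of_anti {s : Set A} (σ : A →ₐ[Kh] Aᵐᵒᵖ)
    (h : ∀ x ∈ s, (σ x).unop ∈ Algebra.adjoin Kh s) {x : A} (hx : x ∈ closedAdjoin s) :
    (σ x).unop ∈ closedAdjoin s := by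
  have key : ∀ y ∈ Algebra.adjoin Kh s, (σ y).unop ∈ Algebra.adjoin Kh s := fun y hy => by
    induction hy using Algebra.adjoin_induction with
    | mem x hx => exact h x hx
    | algebraMap r => rw [AlgHom.commutes]; exact Subalgebra.algebraMap_mem _ r
    | add x y _ _ hx hy => rw [map_add]; exact add_mem hx hy
    | mul x y _ _ hx hy => rw [map_mul]; exact mul_mem hy hx
  intro n
  obtain ⟨y, hy, z, hz⟩ := hx n
  refine ⟨(σ y).unop, key y hy, (σ z).unop, ?_⟩
  rw [← MulOpposite.unop_sub, ← map_sub, hz, map_smul, MulOpposite.unop_smul]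

/-- The inclusion of the completed tensor square of a subalgebra. -/
def tensorIncl (S : Subalgebra Kh A) : Tensor S S →ₐ[Kh] Tensor A A :=
  mapAlg (Algebra.TensorProduct.map S.val S.val)

theorem of_tmul_mem_range (S : Subalgebra Kh A) {a b : A} (ha : a ∈ S) (hb : b ∈ S) :
    of (a ⊗ₜ b) ∈ (tensorIncl S).range :=
  ⟨of ((⟨a, ha⟩ : S) ⊗ₜ (⟨b, hb⟩ : S)), rfl⟩

theorem mem_range_map_of_mem_range {S : Subalgebra Kh A} {x : Tensor A A}
    (hx : x ∈ (tensorIncl S).range) :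
    x ∈ LinearMap.range (HC.map (A := S ⊗[Kh] S) (B := A ⊗[Kh] A)
      (TensorProduct.map S.val.toLinearMap S.val.toLinearMap)) := by
  obtain ⟨y, rfl⟩ := hx
  exact ⟨y, rfl⟩

end

/-! ### The seaweed subalgebra is stable under skew primitive coproducts and scalar antipodes. -/

namespace Uq

open HC

variable {N : ℕ}

theorem freeCartan_add (x y : Cartan N) : freeCartan (x + y) = freeCartan x + freeCartan y := by
  simp [freeCartan, add_smul, Finset.sum_add_distrib]

theorem freeCartan_smul (c : ℂ) (x : Cartan N) :
    freeCartan (c • x) = PowerSeries.C c • freeCartan x := by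
  simp [freeCartan, mul_smul, Finset.smul_sum]

theorem genH_add (x y : Cartan N) : genH (x + y) = genH x + genH y := by
  rw [genH, freeCartan_add, map_add]; rfl

theorem genH_smul (c : ℂ) (x : Cartan N) : genH (c • x) = PowerSeries.C c • genH x := by
  rw [genH, freeCartan_smul, map_smul]; rfl

/-- `x ↦ genH x` is additive. -/
def genHHom : Cartan N →+ HC (FreeGen N) := AddMonoidHom.mk' genH genH_add

theorem genH_eq_sum (x : Cartan N) : genH x = ∑ i, PowerSeries.C (x i) • genH (coroot i) := by
  simp only [← genH_smul]
  change genHHom x = ∑ i, genHHom _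
  rw [← map_sum]
  congr 1
  funext i
  simp [coroot, Finset.sum_apply, Pi.single_apply]

theorem map_genH_ext {T : Type*} [AddCommGroup T] [Module Kh T] {φ ψ : HC (FreeGen N) →ₗ[Kh] T}
    (h : ∀ i, φ (genH (coroot i)) = ψ (genH (coroot i))) (x : Cartan N) :
    φ (genH x) = ψ (genH x) := by
  rw [genH_eq_sum, map_sum, map_sum]
  simp only [map_smul, h]

theorem genH_mem_adjoin {s : Set (HC (FreeGen N))} {t : Set (Cartan N)}
    (hst : ∀ x ∈ t, genH x ∈ s) {x : Cartan N} (hx : x ∈ Submodule.span ℂ t) :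
    genH x ∈ Algebra.adjoin Kh s := by
  induction hx using Submodule.span_induction with
  | mem x hx => exact Algebra.subset_adjoin (hst x hx)
  | zero =>
    rw [← zero_smul ℂ (0 : Cartan N), genH_smul, map_zero, zero_smul]
    exact zero_mem _
  | add x y _ _ hx hy => rw [genH_add]; exact add_mem hx hy
  | smul c x _ hx => rw [genH_smul]; exact Subalgebra.smul_mem _ hx _

section seaweed

/-- The generators of the seaweed algebra. -/
def seaweedGen : Set (HC (FreeGen 4)) :=
  {genH (coroot 1), genH (coroot 2), genH p5, genF 0, genE 3, genE 1, genF 1, genE 2, genF 2}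

/-- The Cartan part of the seaweed algebra. -/
def seaweedCartan : Submodule ℂ (Cartan 4) := Submodule.span ℂ {coroot 1, coroot 2, p5}

theorem genH_mem_seaweed {x : Cartan 4} (hx : x ∈ seaweedCartan) :
    genH x ∈ Algebra.adjoin Kh seaweedGen := by
  refine genH_mem_adjoin ?_ hx
  rintro x (rfl | rfl | rfl) <;> simp [seaweedGen]

theorem H_mem_seaweed {x : Cartan 4} (hx : x ∈ seaweedCartan) : H x ∈ UqSW5 :=
  ⟨genH x, subset_closedAdjoin (genH_mem_seaweed hx), rfl⟩

theorem qH_mem_seaweed {x : Cartan 4} (hx : x ∈ seaweedCartan) : qH x ∈ UqSW5 :=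
  ⟨qpow (freeCartan x), mem_closedAdjoin_of_isHSum (qpow_isHSum _) fun n =>
    Subalgebra.smul_mem _ (pow_mem (genH_mem_seaweed hx) n) _, rfl⟩

theorem E_mem_seaweed {i : Fin 4} (hi : i ≠ 0) : E i ∈ UqSW5 := by
  refine ⟨genE i, subset_closedAdjoin (Algebra.subset_adjoin ?_), rfl⟩
  fin_cases i <;> simp at hi ⊢

theorem F_mem_seaweed {i : Fin 4} (hi : i ≠ 3) : F i ∈ UqSW5 := by
  refine ⟨genF i, subset_closedAdjoin (Algebra.subset_adjoin ?_), rfl⟩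
  fin_cases i <;> simp at hi ⊢

theorem mem_seaweedGen {x : HC (FreeGen 4)} (hx : x ∈ seaweedGen) :
    (∃ y ∈ ({coroot 1, coroot 2, p5} : Set (Cartan 4)), x = genH y) ∨
      (∃ i, i ≠ 0 ∧ x = genE i) ∨ ∃ i, i ≠ 3 ∧ x = genF i := by
  rw [seaweedGen] at hx
  simp only [Set.mem_insert_iff, Set.mem_singleton_iff] at hx
  rcases hx with h | h | h | h | h | h | h | h | h
  · exact Or.inl ⟨_, by simp, h⟩
  · exact Or.inl ⟨_, by simp, h⟩
  · exact Or.inl ⟨_, by simp, h⟩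
  · exact Or.inr (Or.inr ⟨_, by decide, h⟩)
  · exact Or.inr (Or.inl ⟨_, by decide, h⟩)
  · exact Or.inr (Or.inl ⟨_, by decide, h⟩)
  · exact Or.inr (Or.inr ⟨_, by decide, h⟩)
  · exact Or.inr (Or.inl ⟨_, by decide, h⟩)
  · exact Or.inr (Or.inr ⟨_, by decide, h⟩)

/-- A projection of the Cartan subalgebra to that of the seaweed algebra, on the basis. -/
def seaweedProj (i : Fin 4) : Cartan 4 :=
  -- With $h_{\alpha_4}\mapsto0$ and $h_{\alpha_2},h_{\alpha_3}$ fixed, the image of $h_{\alpha_1}$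
  -- is the one for which $p_5$ is fixed.
  ![(5 / 3 : ℂ) • p5 - (1 / 3 : ℂ) • coroot 1 + (1 / 3 : ℂ) • coroot 2, coroot 1, coroot 2, 0] i

theorem coroot_one_mem : coroot 1 ∈ seaweedCartan := Submodule.subset_span (by simp)

theorem coroot_two_mem : coroot 2 ∈ seaweedCartan := Submodule.subset_span (by simp)

theorem p5_mem : p5 ∈ seaweedCartan := Submodule.subset_span (by simp)

theorem seaweedProj_mem (i : Fin 4) : seaweedProj i ∈ seaweedCartan := by
  fin_cases i
  · exact add_mem (sub_mem (Submodule.smul_mem _ _ p5_mem) (Submodule.smul_mem _ _ coroot_one_mem))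
      (Submodule.smul_mem _ _ coroot_two_mem)
  · exact coroot_one_mem
  · exact coroot_two_mem
  · exact zero_mem _

/-- A retraction of the completed free algebra to the subalgebra that covers the seaweed algebra. -/
def seaweedRetract : HC (FreeGen 4) →ₐ[Kh] HC (FreeGen 4) :=
  freeLift (fun i => genH (seaweedProj i)) (fun i => if i = 0 then 0 else genE i)
    (fun i => if i = 3 then 0 else genF i)

theorem seaweedRetract_p5 : seaweedRetract (genH p5) = genH p5 := by
  rw [genH_eq_sum p5, map_sum]
  simp only [map_smul]
  simp only [seaweedRetract, freeLift_h, ← genH_smul]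
  change ∑ i, genHHom _ = ∑ i, genHHom _
  rw [← map_sum, ← map_sum]
  congr 1
  funext j
  simp only [Fin.sum_univ_four, seaweedProj, p5, coroot]
  fin_cases j <;> simp <;> norm_num

theorem seaweedRetract_eq {x : HC (FreeGen 4)} (hx : x ∈ closedAdjoin seaweedGen) :
    seaweedRetract x = x := by
  refine map_eq_of_mem_closedAdjoin (ψ := AlgHom.id Kh _) (fun x hx => ?_) hx
  rw [AlgHom.id_apply]
  rcases mem_seaweedGen hx with ⟨y, rfl | rfl | rfl, rfl⟩ | ⟨i, hi, rfl⟩ | ⟨i, hi, rfl⟩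
  · exact freeLift_h _ _ _ _
  · exact freeLift_h _ _ _ _
  · exact seaweedRetract_p5
  · exact (freeLift_e _ _ _ _).trans (if_neg hi)
  · exact (freeLift_f _ _ _ _).trans (if_neg hi)

/-- The seaweed algebra has no presentation at hand from which to define a map into its completed
tensor square. That tensor square is complete, however, so preimages of the coproducts of the
generators define a homomorphism from the completed free algebra. Composed with `tensorIncl` it
equals $\Delta$ after `seaweedRetract`, and the retraction fixes the closed subalgebra covering the
seaweed algebra. -/
theorem comul_mem_seaweed {Δ : Uq 4 →ₐ[Kh] Tensor (Uq 4) (Uq 4)} {a b c d : Fin 4 → Cartan 4}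
    (hΔ : IsSkewPrimitive Δ a b c d) (ha : ∀ i ≠ 0, a i ∈ seaweedCartan)
    (hb : ∀ i ≠ 0, b i ∈ seaweedCartan) (hc : ∀ i ≠ 3, c i ∈ seaweedCartan)
    (hd : ∀ i ≠ 3, d i ∈ seaweedCartan) {x : Uq 4} (hx : x ∈ UqSW5) :
    Δ x ∈ (tensorIncl UqSW5).range := by
  have hh : ∀ i, ∃ t, tensorIncl UqSW5 t = Δ (H (seaweedProj i)) := fun i => by
    rw [hΔ.comul_H, map_add]
    have := H_mem_seaweed (seaweedProj_mem i)
    exact add_mem (of_tmul_mem_range _ this (one_mem _)) (of_tmul_mem_range _ (one_mem _) this)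
  have he : ∀ i, ∃ t, tensorIncl UqSW5 t = Δ (mk (if i = 0 then 0 else genE i)) := fun i => by
    split_ifs with hi
    · exact ⟨0, by simp only [map_zero]⟩
    · change ∃ t, tensorIncl UqSW5 t = Δ (E i)
      rw [hΔ.e, map_add]
      exact add_mem (of_tmul_mem_range _ (qH_mem_seaweed (ha i hi)) (E_mem_seaweed hi))
        (of_tmul_mem_range _ (E_mem_seaweed hi) (qH_mem_seaweed (hb i hi)))
  have hf : ∀ i, ∃ t, tensorIncl UqSW5 t = Δ (mk (if i = 3 then 0 else genF i)) := fun i => by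
    split_ifs with hi
    · exact ⟨0, by simp only [map_zero]⟩
    · change ∃ t, tensorIncl UqSW5 t = Δ (F i)
      rw [hΔ.f, map_add]
      exact add_mem (of_tmul_mem_range _ (F_mem_seaweed hi) (qH_mem_seaweed (hc i hi)))
        (of_tmul_mem_range _ (qH_mem_seaweed (hd i hi)) (F_mem_seaweed hi))
  choose th hth using hh
  choose te hte using he
  choose tf htf using hf
  have key : (tensorIncl UqSW5).comp (freeLift th te tf) = (Δ.comp mk).comp seaweedRetract := by
    refine free_hom_ext (fun i => ?_) (fun i => ?_) (fun i => ?_)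
    · simp only [AlgHom.comp_apply, seaweedRetract, freeLift_h, hth]
      rfl
    · simp only [AlgHom.comp_apply, seaweedRetract, freeLift_e, hte]
    · simp only [AlgHom.comp_apply, seaweedRetract, freeLift_f, htf]
  obtain ⟨z, hz, rfl⟩ := hx
  refine ⟨freeLift th te tf z, ?_⟩
  have := AlgHom.congr_fun key z
  simp only [AlgHom.comp_apply, seaweedRetract_eq hz] at this
  exact this

/-- The antipode is lifted to an anti-homomorphism `σ` of the completed free algebra that acts on
each generator by a scalar, hence preserves the closed subalgebra they generate. -/
theorem antipode_mem_seaweed {S : Uq 4 →ₐ[Kh] (Uq 4)ᵐᵒᵖ} {u v : Kh}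
    (hh : ∀ i, S (H (coroot i)) = MulOpposite.op (-H (coroot i)))
    (he : ∀ i, S (E i) = MulOpposite.op (-(u • E i)))
    (hf : ∀ i, S (F i) = MulOpposite.op (-(v • F i))) {x : Uq 4} (hx : x ∈ UqSW5) :
    unopLinear S x ∈ UqSW5 := by
  let σ : HC (FreeGen 4) →ₐ[Kh] (HC (FreeGen 4))ᵐᵒᵖ :=
    freeLift (fun i => MulOpposite.op (-genH (coroot i))) (fun i => MulOpposite.op (-(u • genE i)))
      (fun i => MulOpposite.op (-(v • genF i)))
  have hσ : (AlgHom.op mk).comp σ = S.comp mk := by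
    refine free_hom_ext (fun i => ?_) (fun i => ?_) (fun i => ?_)
    · exact (congrArg (AlgHom.op mk) (freeLift_h _ _ _ i)).trans
        (Eq.trans (congrArg MulOpposite.op (map_neg mk _)) (hh i).symm)
    · exact (congrArg (AlgHom.op mk) (freeLift_e _ _ _ i)).trans
        (Eq.trans (congrArg MulOpposite.op ((map_neg mk _).trans (by rw [map_smul]; rfl)))
          (he i).symm)
    · exact (congrArg (AlgHom.op mk) (freeLift_f _ _ _ i)).trans
        (Eq.trans (congrArg MulOpposite.op ((map_neg mk _).trans (by rw [map_smul]; rfl)))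
          (hf i).symm)
  have hσh : ∀ i, (σ (genH (coroot i))).unop = -genH (coroot i) := fun i =>
    congrArg MulOpposite.unop (freeLift_h _ _ _ i)
  have hσe : ∀ i, (σ (genE i)).unop = -(u • genE i) := fun i =>
    congrArg MulOpposite.unop (freeLift_e _ _ _ i)
  have hσf : ∀ i, (σ (genF i)).unop = -(v • genF i) := fun i =>
    congrArg MulOpposite.unop (freeLift_f _ _ _ i)
  have hσH : ∀ x, (σ (genH x)).unop = -genH x := fun x => by
    have := map_genH_ext (φ := unopLinear σ) (ψ := -LinearMap.id) (fun i => by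
      rw [unopLinear_apply, hσh, LinearMap.neg_apply, LinearMap.id_apply]) x
    rwa [unopLinear_apply, LinearMap.neg_apply, LinearMap.id_apply] at this
  obtain ⟨z, hz, rfl⟩ := hx
  refine ⟨(σ z).unop, mem_closedAdjoin_of_anti σ (fun x hx => ?_) hz, ?_⟩
  · have hx' := Algebra.subset_adjoin (R := Kh) hx
    rcases mem_seaweedGen hx with ⟨y, _, rfl⟩ | ⟨i, hi, rfl⟩ | ⟨i, hi, rfl⟩
    · rw [hσH]
      exact neg_mem hx'
    · rw [hσe]
      exact neg_mem (Subalgebra.smul_mem _ hx' _)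
    · rw [hσf]
      exact neg_mem (Subalgebra.smul_mem _ hx' _)
  · exact congrArg MulOpposite.unop (AlgHom.congr_fun hσ z)

end seaweed

end Uq

/-! ### Linear algebra of $r_0(5)$ in coordinates. -/

namespace Uq

section coordinates

variable {N : ℕ}

theorem coords_tmul (x y : Cartan N) (i j : Fin N) : coords (x ⊗ₜ y) i j = x i * y j := by
  simp [coords, Module.Basis.tensorProduct_repr_tmul_apply, mul_comm]

theorem coords_add (r s : Cartan N ⊗[ℂ] Cartan N) (i j : Fin N) :
    coords (r + s) i j = coords r i j + coords s i j := by
  simp [coords]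

theorem coords_smul (c : ℂ) (r : Cartan N ⊗[ℂ] Cartan N) (i j : Fin N) :
    coords (c • r) i j = c * coords r i j := by
  simp [coords]

theorem coords_zero (i j : Fin N) : coords (0 : Cartan N ⊗[ℂ] Cartan N) i j = 0 := by
  simp [coords]

theorem coords_sum {ι : Type*} (s : Finset ι) (r : ι → Cartan N ⊗[ℂ] Cartan N) (i j : Fin N) :
    coords (∑ k ∈ s, r k) i j = ∑ k ∈ s, coords (r k) i j := by
  simp [coords]

theorem ext_coords {r s : Cartan N ⊗[ℂ] Cartan N} (h : ∀ i j, coords r i j = coords s i j) :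
    r = s :=
  ((Pi.basisFun ℂ (Fin N)).tensorProduct (Pi.basisFun ℂ (Fin N))).ext_elem fun p => h p.1 p.2

theorem coords_comm (r : Cartan N ⊗[ℂ] Cartan N) (i j : Fin N) :
    coords (TensorProduct.comm ℂ (Cartan N) (Cartan N) r) i j = coords r j i := by
  induction r using TensorProduct.induction_on with
  | zero => simp [coords_zero]
  | tmul x y => rw [TensorProduct.comm_tmul, coords_tmul, coords_tmul, mul_comm]
  | add r s hr hs => rw [map_add, coords_add, coords_add, hr, hs]

theorem lid_map_simpleRoot (r : Cartan N ⊗[ℂ] Cartan N) (j : Fin N) :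
    TensorProduct.lid ℂ (Cartan N) (TensorProduct.map (simpleRoot j) LinearMap.id r) =
      contrLeft r fun i => (CartanMatrix.A N j i : ℂ) := by
  funext l
  induction r using TensorProduct.induction_on with
  | zero => simp [contrLeft, coords_zero]
  | tmul x y =>
    simp only [contrLeft, coords_tmul, TensorProduct.map_tmul, TensorProduct.lid_tmul, simpleRoot]
    simp only [LinearMap.sum_apply, LinearMap.smul_apply, LinearMap.proj_apply, LinearMap.id_apply,
      Pi.smul_apply, smul_eq_mul, Finset.sum_mul]
    exact Finset.sum_congr rfl fun k _ => by ring
  | add r s hr hs =>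
    rw [map_add, map_add, Pi.add_apply, hr, hs]
    simp [contrLeft, coords_add, add_mul, Finset.sum_add_distrib]

theorem rid_map_simpleRoot (r : Cartan N ⊗[ℂ] Cartan N) (j : Fin N) :
    TensorProduct.rid ℂ (Cartan N) (TensorProduct.map LinearMap.id (simpleRoot j) r) =
      contrRight r fun i => (CartanMatrix.A N j i : ℂ) := by
  funext l
  induction r using TensorProduct.induction_on with
  | zero => simp [contrRight, coords_zero]
  | tmul x y =>
    simp only [contrRight, coords_tmul, TensorProduct.map_tmul, TensorProduct.rid_tmul, simpleRoot]
    simp only [LinearMap.sum_apply, LinearMap.smul_apply, LinearMap.proj_apply, LinearMap.id_apply,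
      Pi.smul_apply, smul_eq_mul, Finset.sum_mul]
    exact Finset.sum_congr rfl fun k _ => by ring
  | add r s hr hs =>
    rw [map_add, map_add, Pi.add_apply, hr, hs]
    simp [contrRight, coords_add, add_mul, Finset.sum_add_distrib]

theorem coords_casimirCartan (i j : Fin N) : coords (casimirCartan N) i j =
    ((CartanMatrix.A N).map (Int.cast : ℤ → ℂ))⁻¹ i j := by
  simp only [casimirCartan, coords_sum, coords_smul, coords_tmul, coroot, Pi.single_apply]
  simp

end coordinates

theorem cartanMatrix_four : (CartanMatrix.A 4).map (Int.cast : ℤ → ℂ) =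
    !![2, -1, 0, 0; -1, 2, -1, 0; 0, -1, 2, -1; 0, 0, -1, 2] := by
  ext i j
  fin_cases i <;> fin_cases j <;> simp [CartanMatrix.A]

theorem cartanMatrix_four_apply (i j : Fin 4) : (CartanMatrix.A 4 i j : ℂ) =
    !![2, -1, 0, 0; -1, 2, -1, 0; 0, -1, 2, -1; 0, 0, -1, 2] i j := by
  rw [← cartanMatrix_four, Matrix.map_apply]

theorem cartanMatrix_four_inv : ((CartanMatrix.A 4).map (Int.cast : ℤ → ℂ))⁻¹ =
    !![4/5, 3/5, 2/5, 1/5; 3/5, 6/5, 4/5, 2/5; 2/5, 4/5, 6/5, 3/5; 1/5, 2/5, 3/5, 4/5] := by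
  refine Matrix.inv_eq_right_inv ?_
  rw [cartanMatrix_four]
  ext i j
  fin_cases i <;> fin_cases j <;> simp [Matrix.mul_apply, Fin.sum_univ_four] <;> norm_num

theorem coords_r05 (i j : Fin 4) : coords r05 i j =
    !![2/5, 3/5, 3/5, 2/5; 0, 3/5, 4/5, 3/5; -1/5, 0, 3/5, 3/5; -1/5, -1/5, 0, 2/5] i j := by
  simp only [r05, coords_add, coords_tmul, coroot]
  fin_cases i <;> fin_cases j <;> simp <;> norm_num

/-- Uniqueness: the difference $s$ of two solutions is skew, and the shift equations then make all
contractions $(\alpha_j\otimes1)(s)$ equal, so $s(\alpha_i,\alpha_j)=s(\alpha_j,\alpha_j)=0$. In the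
code the same linear system is solved in the sixteen coordinates. -/
theorem isCremmerGervaisCartanPart_iff (r : Cartan 4 ⊗[ℂ] Cartan 4) :
    IsCremmerGervaisCartanPart r ↔ r = r05 := by
  constructor
  · rintro ⟨h1, h2⟩
    have h1' : ∀ i j, coords r i j + coords r j i =
        !![4/5, 3/5, 2/5, 1/5; 3/5, 6/5, 4/5, 2/5; 2/5, 4/5, 6/5, 3/5; 1/5, 2/5, 3/5, 4/5] i j := by
      intro i j
      rw [← coords_comm r i j, ← coords_add, h1, coords_casimirCartan, cartanMatrix_four_inv]
    have h2' : ∀ i j : Fin 4, i.val + 1 = j.val → ∀ l,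
        ∑ k, coords r k l * (CartanMatrix.A 4 j k : ℂ) +
          ∑ k, coords r l k * (CartanMatrix.A 4 i k : ℂ) = 0 := by
      intro i j hij l
      have := h2 i j hij
      rw [lid_map_simpleRoot, rid_map_simpleRoot] at this
      exact congrFun this l
    simp only [cartanMatrix_four_apply, Fin.sum_univ_four] at h2'
    have e1 := h2' 0 1 rfl
    have e2 := h2' 1 2 rfl
    have e3 := h2' 2 3 rfl
    clear h1 h2 h2'
    refine ext_coords fun i j => ?_
    rw [coords_r05]
    simp only [Fin.forall_fin_succ] at h1' e1 e2 e3
    simp at h1' e1 e2 e3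
    fin_cases i <;> fin_cases j <;> simp <;> grind
  · rintro rfl
    refine ⟨ext_coords fun i j => ?_, fun i j hij => ?_⟩
    · rw [coords_add, coords_comm, coords_casimirCartan, cartanMatrix_four_inv, coords_r05,
        coords_r05]
      fin_cases i <;> fin_cases j <;> simp <;> norm_num
    · rw [lid_map_simpleRoot, rid_map_simpleRoot]
      funext l
      simp only [contrLeft, contrRight, Pi.add_apply, coords_r05, cartanMatrix_four_apply,
        Fin.sum_univ_four]
      fin_cases i <;> fin_cases j <;> simp at hij <;> fin_cases l <;> simp <;> norm_num

/-- The contraction of the left factor of `r₀(5)` with `α_j`. -/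
def contrRoot (j : Fin 4) : Cartan 4 := contrLeft r05 fun i => (CartanMatrix.A 4 j i : ℂ)

theorem contrRoot_eq (j : Fin 4) : contrRoot j = ![
    ![4/5, 3/5, 2/5, 1/5], ![-1/5, 3/5, 2/5, 1/5], ![-1/5, -2/5, 2/5, 1/5],
    ![-1/5, -2/5, -3/5, 1/5]] j := by
  funext l
  simp only [contrRoot, contrLeft, coords_r05, cartanMatrix_four_apply, Fin.sum_univ_four]
  fin_cases j <;> fin_cases l <;> simp <;> norm_num

/-- The contraction of $r+r^{21}=\Omega_0$ with $\alpha_j$, since $\Omega_0$ contracts to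
$h_{\alpha_j}$. -/
theorem contrRight_r05 (j : Fin 4) :
    contrRight r05 (fun i => (CartanMatrix.A 4 j i : ℂ)) = coroot j - contrRoot j := by
  rw [contrRoot_eq]
  funext l
  simp only [contrRight, coords_r05, cartanMatrix_four_apply, Fin.sum_univ_four, coroot]
  fin_cases j <;> fin_cases l <;> simp <;> norm_num

/-- The value is $(\alpha_j\otimes\alpha_j)(r)$, half of $(\alpha_j\otimes\alpha_j)(\Omega_0)=2$. -/
theorem simpleRoot_contrRoot (j : Fin 4) : simpleRoot j (contrRoot j) = 1 := by
  rw [contrRoot_eq, simpleRoot_apply]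
  simp only [cartanMatrix_four_apply, Fin.sum_univ_four]
  fin_cases j <;> simp <;> norm_num

theorem smul_add_smul_add_smul_mem (a b c : ℂ) :
    a • coroot 1 + b • coroot 2 + c • p5 ∈ seaweedCartan :=
  add_mem (add_mem (Submodule.smul_mem _ _ coroot_one_mem) (Submodule.smul_mem _ _ coroot_two_mem))
    (Submodule.smul_mem _ _ p5_mem)

theorem contrRoot_mem {j : Fin 4} (hj : j ≠ 0) : contrRoot j ∈ seaweedCartan := by
  have h : ∃ a b c : ℂ, contrRoot j = a • coroot 1 + b • coroot 2 + c • p5 := by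
    -- The coefficient of $p_5$ is read off from $h_{\alpha_1}$: $-\frac15=-\frac13\cdot\frac35$.
    -- Since $b_{j+1}=b_j-h_{\alpha_j}$, consecutive columns differ by one in a single entry. The
    -- leading zeros are fillers for the excluded index.
    refine ⟨![0, 2/3, -1/3, -1/3] j, ![0, 1/3, 1/3, -2/3] j, -1/3, ?_⟩
    rw [contrRoot_eq]
    funext l
    simp only [p5, coroot]
    fin_cases j <;> simp at hj <;> fin_cases l <;> simp <;> norm_num
  obtain ⟨a, b, c, h⟩ := h
  rw [h]
  exact smul_add_smul_add_smul_mem a b c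

theorem coroot_sub_contrRoot_mem {j : Fin 4} (hj : j ≠ 3) :
    coroot j - contrRoot j ∈ seaweedCartan := by
  have h : ∃ i : Fin 4, i ≠ 0 ∧ coroot j - contrRoot j = -contrRoot i := by
    -- This is the shift equation $h_{\alpha_j}-b_j=-b_{j+1}$; the sum `j + 1` would wrap around to
    -- `0` only at the excluded index `3`.
    refine ⟨j + 1, ?_, ?_⟩
    · fin_cases j <;> simp at hj ⊢
    · rw [contrRoot_eq, contrRoot_eq]
      funext l
      simp only [coroot]
      fin_cases j <;> simp at hj <;> fin_cases l <;> simp <;> norm_num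
  obtain ⟨i, hi, h⟩ := h
  rw [h]
  exact neg_mem (contrRoot_mem hi)

end Uq

end

theorem proposition2 :
    (∀ r : Cartan 4 ⊗[ℂ] Cartan 4, IsCremmerGervaisCartanPart r ↔ r = r05) ∧
    (∃ 𝓗 : TopHopf (Uq 4), Uq.IsStandard 𝓗) ∧
    ∀ 𝓗 : TopHopf (Uq 4), Uq.IsStandard 𝓗 →
      ∃ 𝓗K : TopHopf (Uq 4), TopHopf.IsTwist 𝓗 K5 𝓗K ∧ TopHopf.IsHopfSubalgebra 𝓗K UqSW5 := by
  refine ⟨Uq.isCremmerGervaisCartanPart_iff, Uq.exists_isStandard, fun 𝓗 h𝓗 => ?_⟩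
  obtain ⟨𝓗K, S, htwist, hΔ, hS, hh, he, hf⟩ := Uq.exists_twist h𝓗 (r := r05) (b := Uq.contrRoot)
    (fun _ => rfl) Uq.contrRight_r05 Uq.simpleRoot_contrRoot
  refine ⟨𝓗K, htwist, fun a ha => ?_, fun a ha => ?_⟩
  · exact mem_range_map_of_mem_range (Uq.comul_mem_seaweed hΔ
      (fun i hi => neg_mem (Uq.contrRoot_mem hi)) (fun i hi => Uq.contrRoot_mem hi)
      (fun i hi => Uq.coroot_sub_contrRoot_mem hi)
      (fun i hi => neg_mem (Uq.coroot_sub_contrRoot_mem hi)) ha)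
  · rw [hS]
    exact Uq.antipode_mem_seaweed hh he hf ha
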